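/- Let $k$ be an algebraically closed field of characteristic $0$ and let $(A,R)$ be a minimal triangular pointed Hopf algebra over $k$ with Drinfeld element $u=\sum S(R^{(2)})R^{(1)}$. Here pointed means that every simple subcoalgebra of $A$ is one-dimensional; triangular means that $R\in A\otimes A$ is an invertible element satisfying $\Delta^{cop}(a)R=R\Delta(a)$ for all $a\in A$, $(\Delta\otimes I)(R)=R_{13}R_{23}$, $(I\otimes\Delta)(R)=R_{13}R_{12}$ and $R^{-1}=R_{21}$; and minimal means that no proper sub Hopf algebra $C\subsetneq A$ satisfies $R\in C\otimes C$. Let $K:=k[G(A)]$ be the group algebra of the group $G(A)$ of grouplike elements of $A$, and let $i:K\to A$ be the inclusion. 1) There exists a projection of Hopf algebras $\pi:A\to K$, that is, a Hopf algebra map with $\pi\circ i=\mathrm{id}_K$, such that, with $$B:=\{x\in A\mid (I\otimes\pi)\Delta(x)=x\otimes 1\},$$ which is a subalgebra of $A$, one has a Radford biproduct decomposition $A=B\times K$. Explicitly: $B$, with its multiplication from $A$, carries a coalgebra structure $(\Delta_B,\varepsilon_B)$, a left $K$-action and a left $K$-coaction $b\mapsto\sum b^{(1)}\otimes b^{(2)}$,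 which make it a left $K$-module algebra and a left $K$-comodule coalgebra, such that $b\otimes h\mapsto b\,i(h)$ is a linear isomorphism $B\otimes K\to A$ which carries the smash product and smash coproduct structure on $B\otimes K$, given by $$(b\otimes h)(c\otimes l)=\sum b\,(h_{1}\cdot c)\otimes h_{2}l,\qquad \Delta(b\otimes h)=\sum \bigl(b_{1}\otimes b_{2}^{(1)}h_{1}\bigr)\otimes\bigl(b_{2}^{(2)}\otimes h_{2}\bigr),$$ with unit $1\otimes 1$ and counit $\varepsilon_B\otimes\varepsilon_K$, to the Hopf algebra structure of $A$. 2) There exists $R_K\in K\otimes K$ such that $(K,R_K)$ is minimal triangular and its Drinfeld element $u_K$ satisfies $i(u_K)=u$. -/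

import Mathlib

open scoped TensorProduct

noncomputable section

namespace TriHopf

section Coalgebras

variable {k : Type*} {A : Type*} [Field k] [AddCommGroup A] [Module k A] [Coalgebra k A]

/-- A subspace `C` of a coalgebra is a subcoalgebra if `Δ(C) ⊆ C ⊗ C`
(inside `A ⊗ A`; recall that `C ⊗ C → A ⊗ A` is injective over a field). -/
def IsSubcoalgebra (C : Submodule k A) : Prop :=
  ∀ c ∈ C, Coalgebra.comul (R := k) c ∈ LinearMap.range (TensorProduct.map C.subtype C.subtype)

/-- A subcoalgebra is simple if it is nonzero and has no subcoalgebras besides `0` and itself. -/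
def IsSimpleSubcoalgebra (C : Submodule k A) : Prop :=
  IsSubcoalgebra C ∧ C ≠ ⊥ ∧ ∀ D : Submodule k A, IsSubcoalgebra D → D ≤ C → D = ⊥ ∨ D = C

variable (k A) in
/-- A coalgebra is pointed if all its simple subcoalgebras are one-dimensional. -/
def IsPointed : Prop :=
  ∀ C : Submodule k A, IsSimpleSubcoalgebra C → Module.finrank k C = 1

end Coalgebras

section Triangular

variable {k : Type*} {A : Type*} [Field k] [Ring A] [HopfAlgebra k A]

/-- `R₁₂ = R ⊗ 1`, in `A ⊗ (A ⊗ A)`. -/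
def leg12 (R : A ⊗[k] A) : A ⊗[k] (A ⊗[k] A) :=
  TensorProduct.assoc k A A A (R ⊗ₜ[k] (1 : A))

/-- `R₂₃ = 1 ⊗ R`, in `A ⊗ (A ⊗ A)`. -/
def leg23 (R : A ⊗[k] A) : A ⊗[k] (A ⊗[k] A) :=
  (1 : A) ⊗ₜ[k] R

/-- `R₁₃ = ∑ R⁽¹⁾ ⊗ 1 ⊗ R⁽²⁾`, in `A ⊗ (A ⊗ A)`. -/
def leg13 (R : A ⊗[k] A) : A ⊗[k] (A ⊗[k] A) :=
  (TensorProduct.mk k A A 1).lTensor A R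

/-- `R₂₁ = ∑ R⁽²⁾ ⊗ R⁽¹⁾`. -/
def swap (R : A ⊗[k] A) : A ⊗[k] A :=
  TensorProduct.comm k A A R

/-- `R` is a universal `R`-matrix, i.e. `(A, R)` is a quasitriangular Hopf algebra:
`R` is invertible, `Δᶜᵒᵖ(a) R = R Δ(a)`, `(Δ ⊗ I)(R) = R₁₃ R₂₃`, `(I ⊗ Δ)(R) = R₁₃ R₁₂`. -/
structure IsQuasitriangular (R : A ⊗[k] A) : Prop where
  isUnit : IsUnit R
  swap_comul_mul : ∀ a : A,
    swap (Coalgebra.comul (R := k) a) * R = R * Coalgebra.comul (R := k) a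
  comul_left : TensorProduct.assoc k A A A
    ((Coalgebra.comul (R := k) (A := A)).rTensor A R) = leg13 R * leg23 R
  comul_right : (Coalgebra.comul (R := k) (A := A)).lTensor A R = leg13 R * leg12 R

/-- `(A, R)` is triangular: it is quasitriangular and `R⁻¹ = R₂₁`. -/
structure IsTriangular (R : A ⊗[k] A) : Prop extends IsQuasitriangular R where
  mul_swap : R * swap R = 1
  swap_mul : swap R * R = 1

/-- A subalgebra is a sub Hopf algebra if it is a subcoalgebra stable under the antipode. -/
structure IsSubHopfAlgebra (C : Subalgebra k A) : Prop where
  isSubcoalgebra : IsSubcoalgebra (Subalgebra.toSubmodule C)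
  antipode_mem : ∀ c ∈ C, HopfAlgebra.antipode k c ∈ C

/-- `(A, R)` is minimal triangular: it is triangular, and no proper sub Hopf algebra `C` of `A`
satisfies `R ∈ C ⊗ C`. -/
structure IsMinimalTriangular (R : A ⊗[k] A) : Prop extends IsTriangular R where
  eq_top : ∀ C : Subalgebra k A, IsSubHopfAlgebra C →
    R ∈ LinearMap.range (TensorProduct.map (Subalgebra.toSubmodule C).subtype
      (Subalgebra.toSubmodule C).subtype) → C = ⊤

/-- The Drinfeld element `u = ∑ S(R⁽²⁾) R⁽¹⁾`. -/
def drinfeldElement (R : A ⊗[k] A) : A :=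
  LinearMap.mul' k A ((HopfAlgebra.antipode k (A := A)).rTensor A (swap R))

end Triangular

section Biproduct

/-- The data for Radford's biproduct `B × K`: an algebra and coalgebra `B` which is a left
`K`-module algebra and a left `K`-comodule coalgebra. -/
structure BiproductDatum (k K B : Type*) [Field k] [Ring K] [HopfAlgebra k K]
    [Ring B] [Algebra k B] extends Coalgebra k B where
  /-- the left action `h ⊗ b ↦ h · b` of `K` on `B` -/
  act : K →ₐ[k] Module.End k B
  /-- the left coaction `b ↦ ∑ b⁽¹⁾ ⊗ b⁽²⁾` of `K` on `B` -/
  coact : B →ₗ[k] K ⊗[k] B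
  /-- `h · 1 = ε(h) 1` -/
  act_one : ∀ h : K, act h 1 = Coalgebra.counit (R := k) h • (1 : B)
  /-- `h · (b c) = ∑ (h₁ · b) (h₂ · c)` -/
  act_mul : ∀ (h : K) (b c : B), act h (b * c) =
    LinearMap.mul' k B (TensorProduct.map (act.toLinearMap.flip b) (act.toLinearMap.flip c)
      (Coalgebra.comul (R := k) h))
  /-- coassociativity of the coaction -/
  coact_coassoc : ∀ b : B,
    TensorProduct.assoc k K K B
      ((Coalgebra.comul (R := k) (A := K)).rTensor B (coact b)) = coact.lTensor K (coact b)
  /-- counitality of the coaction -/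
  coact_counit : ∀ b : B,
    TensorProduct.lid k B ((Coalgebra.counit (R := k) (A := K)).rTensor B (coact b)) = b
  /-- `ε_B` is a comodule map: `∑ b⁽¹⁾ ε(b⁽²⁾) = ε(b) 1` -/
  counit_coact : ∀ b : B,
    TensorProduct.rid k K (counit.lTensor K (coact b)) = counit b • (1 : K)
  /-- `Δ_B` is a comodule map:
  `∑ b⁽¹⁾ ⊗ Δ(b⁽²⁾) = ∑ b₁⁽¹⁾ b₂⁽¹⁾ ⊗ (b₁⁽²⁾ ⊗ b₂⁽²⁾)` -/
  comul_coact : ∀ b : B,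
    comul.lTensor K (coact b) =
      (LinearMap.mul' k K).rTensor (B ⊗[k] B)
        (TensorProduct.tensorTensorTensorComm k K B K B
          (TensorProduct.map coact coact (comul b)))

variable {k K B : Type*} [Field k] [Ring K] [HopfAlgebra k K] [Ring B] [Algebra k B]

/-- The smash product multiplication on `B ⊗ K`:
`(b ⊗ h)(c ⊗ l) = ∑ b (h₁ · c) ⊗ h₂ l`. -/
def BiproductDatum.smashMul (D : BiproductDatum k K B) :
    (B ⊗[k] K) ⊗[k] (B ⊗[k] K) →ₗ[k] B ⊗[k] K :=
  TensorProduct.map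
      (LinearMap.mul' k B ∘ₗ (TensorProduct.lift D.act.toLinearMap).lTensor B ∘ₗ
        (TensorProduct.assoc k B K B).toLinearMap)
      (LinearMap.mul' k K) ∘ₗ
    (TensorProduct.tensorTensorTensorComm k (B ⊗[k] K) K B K).toLinearMap ∘ₗ
    ((TensorProduct.assoc k B K K).symm.toLinearMap ∘ₗ
      (Coalgebra.comul (R := k) (A := K)).lTensor B).rTensor (B ⊗[k] K)

/-- The smash coproduct comultiplication on `B ⊗ K`:
`Δ(b ⊗ h) = ∑ (b₁ ⊗ b₂⁽¹⁾ h₁) ⊗ (b₂⁽²⁾ ⊗ h₂)`. -/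
def BiproductDatum.smashComul (D : BiproductDatum k K B) :
    B ⊗[k] K →ₗ[k] (B ⊗[k] K) ⊗[k] (B ⊗[k] K) :=
  ((LinearMap.mul' k K).lTensor B ∘ₗ (TensorProduct.assoc k B K K).toLinearMap).rTensor
      (B ⊗[k] K) ∘ₗ
    (TensorProduct.tensorTensorTensorComm k (B ⊗[k] K) B K K).toLinearMap ∘ₗ
    TensorProduct.map
      ((TensorProduct.assoc k B K B).symm.toLinearMap ∘ₗ D.coact.lTensor B ∘ₗ D.comul)
      (Coalgebra.comul (R := k) (A := K))

/-- The counit `b ⊗ h ↦ ε(b) ε(h)` of the smash coproduct on `B ⊗ K`. -/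
def BiproductDatum.smashCounit (D : BiproductDatum k K B) : B ⊗[k] K →ₗ[k] k :=
  LinearMap.mul' k k ∘ₗ TensorProduct.map D.counit (Coalgebra.counit (R := k) (A := K))

/-- The linear isomorphism `e` identifies `B ⊗ K`, with the smash product and the smash coproduct,
with the Hopf algebra `A`. (So these structures on `B ⊗ K` form a Hopf algebra, i.e. they are a
biproduct `B × K`, and `e` is an isomorphism of Hopf algebras from `B × K` to `A`; antipodes are
unique and hence automatically preserved.) -/
structure BiproductDatum.IsBiproductIso (D : BiproductDatum k K B) {A : Type*} [Ring A]
    [HopfAlgebra k A] (e : B ⊗[k] K ≃ₗ[k] A) : Prop where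
  map_one : e ((1 : B) ⊗ₜ[k] (1 : K)) = 1
  map_mul : ∀ x y : B ⊗[k] K, e (D.smashMul (x ⊗ₜ[k] y)) = e x * e y
  map_counit : ∀ x : B ⊗[k] K, Coalgebra.counit (R := k) (e x) = D.smashCounit x
  map_comul : ∀ x : B ⊗[k] K, Coalgebra.comul (R := k) (e x) =
    TensorProduct.map e.toLinearMap e.toLinearMap (D.smashComul x)

/-- The right coinvariants `{x ∈ A | (I ⊗ π) Δ(x) = x ⊗ 1}` of a Hopf algebra map `π : A → K`,
a subalgebra of `A`. -/
def rightCoinvariants {A : Type*} [Ring A] [HopfAlgebra k A] (π : A →ₐc[k] K) :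
    Subalgebra k A :=
  AlgHom.equalizer
    ((Algebra.TensorProduct.map (AlgHom.id k A) (π : A →ₐ[k] K)).comp (Bialgebra.comulAlgHom k A))
    (Algebra.TensorProduct.includeLeft : A →ₐ[k] A ⊗[k] K)

end Biproduct

/-- The group algebra `k[G(A)]` of the group of grouplike elements of `A`. -/
abbrev GroupLikeAlgebra (k A : Type*) [Field k] [Ring A] [HopfAlgebra k A] : Type _ :=
  MonoidAlgebra k (GroupLike k A)

/-- The inclusion `k[G(A)] → A`, the linear extension of `g ↦ g`. -/
def groupLikeIncl (k A : Type*) [Field k] [Ring A] [HopfAlgebra k A] :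
    GroupLikeAlgebra k A →ₐc[k] A :=
  MonoidAlgebra.liftGroupLikeBialgHom

end TriHopf

end

/-! Contracting the second leg of `R` against functionals gives a linear map from the dual of `A` to
`A`. The identity for `(I ⊗ Δ)(R)` makes it reverse convolution products, and the identity for `(Δ ⊗
I)(R)` makes its image a subcoalgebra. Since `R₂₁ = R⁻¹ = (S ⊗ I)(R)`, contractions of the first leg
are antipodes of contractions of the second, so both legs span the same finite-dimensional sub Hopf
algebra. Minimality forces it to be `A`: thus `A` is finite-dimensional and the contraction is a
linear isomorphism (`IsMinimalTriangular.dualEquiv`).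

Under this isomorphism, evaluation at a grouplike `g` becomes a character `χ_g` of `A`, with `χ_g *
χ_h = χ_{gh}` and `χ_1 = ε`. Pointedness dualises to the statement that every proper two-sided ideal
of `A` lies in some `ker χ_g`, so elements killed by all `χ_g` are nilpotent. In characteristic zero
`k[G(A)]` is semisimple and has no nonzero nil left ideal, so the `χ_g` separate its elements;
counting dimensions, `k[G(A)] → k^{G(A)}` is bijective
(`IsMinimalTriangular.characters_groupLikeIncl_bijective`). Composing `A → k^{G(A)}` with the
inverse gives `π`, characterised by `χ_g ∘ i ∘ π = χ_g`. Multiplicativity of `χ_g` in `g` makes `π`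
a coalgebra map.

The decomposition is then Radford's theorem for a split projection onto a group algebra
(`isBiproductIso_biproductEquiv`). A coaction of `k[G]` is a `G`-grading, `B` is the component of
degree `1`, and `Π(a) = a ι(g⁻¹)` for `a` of degree `g` defines a projection onto `B` through which
all structure on `B` is inherited from `A`.

For the second claim take `R_K = (π ⊗ π)(R)`. Its contraction map is injective because `χ_g`
recovers `p(g)` from the contraction by `p`; hence `R_K` is minimal. Its Drinfeld element is `π(u)`.
Triangularity makes `u` grouplike (`IsTriangular.comul_drinfeldElement`), so `i(π(u)) = u`. -/

noncomputable section

namespace TriHopf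

/-! ### Contractions of tensors over a field. -/

section Slices

variable {k M N M' N' : Type*} [Field k] [AddCommGroup M] [Module k M] [AddCommGroup N] [Module k N]
  [AddCommGroup M'] [Module k M'] [AddCommGroup N'] [Module k N']

/-- The contraction `q ↦ (I ⊗ q)(x)` of a tensor `x` in its second leg. -/
def rightSlice : M ⊗[k] N →ₗ[k] Module.Dual k N →ₗ[k] M :=
  (LinearMap.llcomp k (M ⊗[k] N) (M ⊗[k] k) M (TensorProduct.rid k M).toLinearMap ∘ₗ
    LinearMap.lTensorHom M).flip

/-- The contraction `p ↦ (p ⊗ I)(x)` of a tensor `x` in its first leg. -/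
def leftSlice : M ⊗[k] N →ₗ[k] Module.Dual k M →ₗ[k] N :=
  rightSlice ∘ₗ (TensorProduct.comm k M N).toLinearMap

@[simp]
theorem rightSlice_tmul (m : M) (n : N) (q : Module.Dual k N) :
    rightSlice (m ⊗ₜ[k] n) q = q n • m := by
  simp [rightSlice]

@[simp]
theorem leftSlice_tmul (m : M) (n : N) (p : Module.Dual k M) :
    leftSlice (m ⊗ₜ[k] n) p = p m • n := by
  simp [leftSlice]

theorem rightSlice_map (f : M →ₗ[k] M') (g : N →ₗ[k] N') (x : M ⊗[k] N) (q : Module.Dual k N') :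
    rightSlice (TensorProduct.map f g x) q = f (rightSlice x (q ∘ₗ g)) := by
  induction x with
  | zero => simp
  | tmul m n => simp
  | add x y hx hy => simp [hx, hy]

theorem leftSlice_map (f : M →ₗ[k] M') (g : N →ₗ[k] N') (x : M ⊗[k] N) (p : Module.Dual k M') :
    leftSlice (TensorProduct.map f g x) p = g (leftSlice x (p ∘ₗ f)) := by
  induction x with
  | zero => simp
  | tmul m n => simp
  | add x y hx hy => simp [hx, hy]

theorem apply_rightSlice (x : M ⊗[k] N) (p : Module.Dual k M) (q : Module.Dual k N) :
    p (rightSlice x q) = LinearMap.mul' k k (TensorProduct.map p q x) := by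
  induction x with
  | zero => simp
  | tmul m n => simp [mul_comm]
  | add x y hx hy => simp [hx, hy]

theorem apply_leftSlice (x : M ⊗[k] N) (p : Module.Dual k M) (q : Module.Dual k N) :
    q (leftSlice x p) = LinearMap.mul' k k (TensorProduct.map p q x) := by
  induction x with
  | zero => simp
  | tmul m n => simp
  | add x y hx hy => simp [hx, hy]

theorem eq_of_rightSlice_eq {x y : M ⊗[k] N} (h : ∀ q, rightSlice x q = rightSlice y q) :
    x = y := by
  classical
  let b := Module.Basis.ofVectorSpace k N
  apply (TensorProduct.equivFinsuppOfBasisRight b).injective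
  ext i
  rw [TensorProduct.equivFinsuppOfBasisRight_apply, TensorProduct.equivFinsuppOfBasisRight_apply]
  exact h (b.coord i)

theorem eq_of_leftSlice_eq {x y : M ⊗[k] N} (h : ∀ p, leftSlice x p = leftSlice y p) :
    x = y :=
  (TensorProduct.comm k M N).injective (eq_of_rightSlice_eq h)

/-- Tensors are separated by pure tensors of functionals. -/
theorem eq_of_forall_dual {x y : M ⊗[k] N} (h : ∀ (p : Module.Dual k M) (q : Module.Dual k N),
    LinearMap.mul' k k (TensorProduct.map p q x) = LinearMap.mul' k k (TensorProduct.map p q y)) :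
    x = y := by
  refine eq_of_rightSlice_eq fun q ↦ (Module.forall_dual_apply_eq_zero_iff k _).1 ?_ |> sub_eq_zero.1
  intro p
  rw [map_sub, apply_rightSlice, apply_rightSlice, h, sub_self]

/-- Both subspaces have linear retractions. Each retraction fixes `x` because it fixes every slice
of `x`, so `x` is the image of its own retraction. -/
theorem mem_range_map_subtype {P : Submodule k M} {Q : Submodule k N} {x : M ⊗[k] N}
    (hP : ∀ q, rightSlice x q ∈ P) (hQ : ∀ p, leftSlice x p ∈ Q) :
    x ∈ LinearMap.range (TensorProduct.map P.subtype Q.subtype) := by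
  obtain ⟨f, hf⟩ := P.subtype.exists_leftInverse_of_injective P.ker_subtype
  obtain ⟨g, hg⟩ := Q.subtype.exists_leftInverse_of_injective Q.ker_subtype
  have hf' : ∀ m ∈ P, (f m : M) = m := fun m hm ↦ congr_arg Subtype.val (LinearMap.congr_fun hf ⟨m, hm⟩)
  have hg' : ∀ n ∈ Q, (g n : N) = n := fun n hn ↦ congr_arg Subtype.val (LinearMap.congr_fun hg ⟨n, hn⟩)
  refine ⟨TensorProduct.map f g x, ?_⟩
  have h₁ : TensorProduct.map (P.subtype ∘ₗ f) LinearMap.id x = x :=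
    eq_of_rightSlice_eq fun q ↦ by
      rw [rightSlice_map]
      exact hf' _ (hP _)
  have h₂ : TensorProduct.map LinearMap.id (Q.subtype ∘ₗ g) x = x :=
    eq_of_leftSlice_eq fun q ↦ by
      rw [leftSlice_map]
      exact hg' _ (hQ _)
  conv_rhs => rw [← h₁, ← h₂]
  rw [← LinearMap.comp_apply, ← LinearMap.comp_apply, ← TensorProduct.map_comp,
    ← TensorProduct.map_comp, LinearMap.id_comp, LinearMap.comp_id]

theorem rightSlice_mem {P : Submodule k M} {Q : Submodule k N} {x : M ⊗[k] N}
    (h : x ∈ LinearMap.range (TensorProduct.map P.subtype Q.subtype)) (q : Module.Dual k N) :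
    rightSlice x q ∈ P := by
  obtain ⟨y, rfl⟩ := h
  rw [rightSlice_map]
  exact Subtype.property _

/-- A tensor is a finite sum of pure tensors. This is the source of the finite-dimensionality of
`A`. -/
theorem finiteDimensional_range_rightSlice (x : M ⊗[k] N) :
    FiniteDimensional k (LinearMap.range (rightSlice x)) := by
  induction x with
  | zero => rw [map_zero, LinearMap.range_zero]; infer_instance
  | tmul m n =>
    refine Submodule.finiteDimensional_of_le (S₂ := k ∙ m) ?_
    rintro _ ⟨q, rfl⟩
    rw [rightSlice_tmul]
    exact Submodule.smul_mem _ _ (Submodule.mem_span_singleton_self m)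
  | add x y hx hy =>
    refine Submodule.finiteDimensional_of_le
      (S₂ := LinearMap.range (rightSlice x) ⊔ LinearMap.range (rightSlice y)) ?_
    rintro _ ⟨q, rfl⟩
    rw [map_add, LinearMap.add_apply]
    exact Submodule.add_mem_sup ⟨q, rfl⟩ ⟨q, rfl⟩

end Slices

end TriHopf
end

noncomputable section

namespace TriHopf

/-! ### The legs of `R`, and self-duality in the minimal case. -/

section Quasitriangular

variable {k A : Type*} [Field k] [Ring A] [HopfAlgebra k A]

/-- The convolution product of two functionals on a coalgebra. -/
def convDual (p q : Module.Dual k A) : Module.Dual k A :=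
  LinearMap.mul' k k ∘ₗ TensorProduct.map p q ∘ₗ Coalgebra.comul

theorem rightSlice_leg13_mul_leg12 (x y : A ⊗[k] A) (p q : Module.Dual k A) :
    rightSlice (leg13 x * leg12 y) (LinearMap.mul' k k ∘ₗ TensorProduct.map q p) =
      rightSlice x p * rightSlice y q := by
  induction x with
  | zero => simp [leg13]
  | add x x' hx hx' => simp only [leg13, map_add, add_mul, LinearMap.add_apply] at *; rw [hx, hx']
  | tmul a b =>
    induction y with
    | zero => simp [leg12]
    | add y y' hy hy' =>
      simp only [leg12, map_add, TensorProduct.add_tmul, mul_add, LinearMap.add_apply] at *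
      rw [hy, hy']
    | tmul c d => simp [leg13, leg12, mul_smul]

/-- On pure tensors both sides are `p(bd) a ⊗ c`. The right-hand form lets the comultiplication of a
slice be read off from `R ⊗ R`. -/
theorem lTensor_slice_leg13_mul_leg23 (x y : A ⊗[k] A) (p : Module.Dual k A) :
    TensorProduct.map LinearMap.id ((rightSlice (k := k) (M := A) (N := A)).flip p)
        (leg13 x * leg23 y) =
      rightSlice (TensorProduct.tensorTensorTensorComm k A A A A (x ⊗ₜ[k] y))
        (p ∘ₗ LinearMap.mul' k A) := by
  induction x with
  | zero => simp [leg13]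
  | add x x' hx hx' =>
    simp only [leg13, map_add, add_mul, TensorProduct.add_tmul, LinearMap.add_apply] at *
    rw [hx, hx']
  | tmul a b =>
    induction y with
    | zero => simp [leg23]
    | add y y' hy hy' =>
      simp only [leg23, map_add, TensorProduct.tmul_add, mul_add, LinearMap.add_apply] at *
      rw [hy, hy']
    | tmul c d => simp [leg13, leg23]

theorem rightSlice_map_antipode_mul (x y : A ⊗[k] A) (p : Module.Dual k A) :
    rightSlice (TensorProduct.map (HopfAlgebra.antipode k) LinearMap.id x * y) p =
      LinearMap.mul' k A ((HopfAlgebra.antipode k).rTensor A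
        (rightSlice (TensorProduct.tensorTensorTensorComm k A A A A (x ⊗ₜ[k] y))
          (p ∘ₗ LinearMap.mul' k A))) := by
  induction x with
  | zero => simp
  | add x x' hx hx' =>
    simp only [map_add, add_mul, TensorProduct.add_tmul, LinearMap.add_apply] at *
    rw [hx, hx']
  | tmul a b =>
    induction y with
    | zero => simp
    | add y y' hy hy' =>
      simp only [map_add, TensorProduct.tmul_add, mul_add, LinearMap.add_apply] at *
      rw [hy, hy']
    | tmul c d => simp

theorem mul'_map_rightSlice_tensorTensorTensorComm (x y : A ⊗[k] A) (p r s : Module.Dual k A) :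
    LinearMap.mul' k k (TensorProduct.map r s
      (rightSlice (TensorProduct.tensorTensorTensorComm k A A A A (x ⊗ₜ[k] y))
        (p ∘ₗ LinearMap.mul' k A))) = p (leftSlice x r * leftSlice y s) := by
  induction x with
  | zero => simp
  | add x x' hx hx' =>
    simp only [map_add, add_mul, TensorProduct.add_tmul, LinearMap.add_apply] at *
    rw [hx, hx']
  | tmul a b =>
    induction y with
    | zero => simp
    | add y y' hy hy' =>
      simp only [map_add, TensorProduct.tmul_add, mul_add, LinearMap.add_apply] at *
      rw [hy, hy']
    | tmul c d => simp; ring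

theorem rightSlice_mul_tmul_one (x : A ⊗[k] A) (c : A) (p : Module.Dual k A) :
    rightSlice (x * c ⊗ₜ[k] (1 : A)) p = rightSlice x p * c := by
  induction x with
  | zero => simp
  | tmul a b => simp
  | add x y hx hy => simp [add_mul, hx, hy]

theorem leftSlice_one_tmul_mul (x : A ⊗[k] A) (c : A) (p : Module.Dual k A) :
    leftSlice ((1 : A) ⊗ₜ[k] c * x) p = c * leftSlice x p := by
  induction x with
  | zero => simp
  | tmul a b => simp
  | add x y hx hy => simp [mul_add, hx, hy]

variable {R : A ⊗[k] A}

theorem apply_rightSlice_eq_apply_leftSlice (R : A ⊗[k] A) (p r : Module.Dual k A) :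
    r (rightSlice R p) = p (leftSlice R r) := by
  rw [apply_rightSlice, apply_leftSlice]

/-- This is `(I ⊗ Δ)(R) = R₁₃ R₁₂` contracted in its last two legs; the factor `R₁₃` standing on the
left is what reverses the convolution product. -/
theorem IsQuasitriangular.rightSlice_mul (hR : IsQuasitriangular R) (p q : Module.Dual k A) :
    rightSlice R p * rightSlice R q = rightSlice R (convDual q p) := by
  rw [← rightSlice_leg13_mul_leg12, ← hR.comul_right, LinearMap.lTensor, rightSlice_map,
    LinearMap.comp_assoc]
  rfl

theorem IsQuasitriangular.comul_rightSlice (hR : IsQuasitriangular R) (p : Module.Dual k A) :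
    Coalgebra.comul (R := k) (rightSlice R p) =
      rightSlice (TensorProduct.tensorTensorTensorComm k A A A A (R ⊗ₜ[k] R))
        (p ∘ₗ LinearMap.mul' k A) := by
  rw [← lTensor_slice_leg13_mul_leg23, ← hR.comul_left]
  have key : ∀ x : (A ⊗[k] A) ⊗[k] A,
      TensorProduct.map LinearMap.id ((rightSlice (k := k) (M := A) (N := A)).flip p)
        (TensorProduct.assoc k A A A x) = rightSlice x p := by
    intro x
    induction x with
    | zero => simp
    | add x y hx hy => simp only [map_add, hx, hy, LinearMap.add_apply]
    | tmul x c =>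
      induction x with
      | zero => simp
      | add x y hx hy => simp only [map_add, hx, hy, LinearMap.add_apply, TensorProduct.add_tmul]
      | tmul a b => simp
  rw [key, LinearMap.rTensor, rightSlice_map]
  rfl

/-- The identity for `(Δ ⊗ I)(R)` in scalar form: comultiplying a right slice is dual to multiplying
left slices. -/
theorem IsQuasitriangular.mul'_map_comul_rightSlice (hR : IsQuasitriangular R)
    (p r s : Module.Dual k A) :
    LinearMap.mul' k k (TensorProduct.map r s (Coalgebra.comul (R := k) (rightSlice R p))) =
      p (leftSlice R r * leftSlice R s) := by
  rw [hR.comul_rightSlice, mul'_map_rightSlice_tensorTensorTensorComm]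

/-- With `e = (I ⊗ ε)(R)`, the counit is neutral for convolution, so every slice satisfies `r e =
r`. Hence `R (e ⊗ 1) = R`, and `R` can be cancelled. -/
theorem IsQuasitriangular.rightSlice_counit (hR : IsQuasitriangular R) :
    rightSlice R (Coalgebra.counit (R := k)) = 1 := by
  have h : R * (rightSlice R (Coalgebra.counit (R := k)) - 1) ⊗ₜ[k] (1 : A) = 0 := by
    refine eq_of_rightSlice_eq fun p ↦ ?_
    rw [rightSlice_mul_tmul_one, mul_sub, hR.rightSlice_mul, mul_one, map_zero,
      LinearMap.zero_apply, sub_eq_zero]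
    congr 1
    ext a
    have : TensorProduct.map (Coalgebra.counit (R := k)) p (Coalgebra.comul (R := k) a) =
        (1 : k) ⊗ₜ[k] p a := by
      rw [← LinearMap.lTensor_comp_rTensor, LinearMap.comp_apply,
        Coalgebra.rTensor_counit_comul, LinearMap.lTensor_tmul]
    simp [convDual, this]
  have h₂ := (hR.isUnit.mul_right_eq_zero).1 h
  have := congr_arg (fun x ↦ rightSlice x (Coalgebra.counit (R := k))) h₂
  simpa [sub_eq_zero] using this

theorem IsQuasitriangular.leftSlice_counit (hR : IsQuasitriangular R) :
    leftSlice R (Coalgebra.counit (R := k)) = 1 := by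
  have h : (1 : A) ⊗ₜ[k] (leftSlice R (Coalgebra.counit (R := k)) - 1) * R = 0 := by
    refine eq_of_leftSlice_eq fun s ↦ ?_
    rw [leftSlice_one_tmul_mul, sub_mul, one_mul, map_zero, LinearMap.zero_apply, sub_eq_zero]
    refine (Module.forall_dual_apply_eq_zero_iff k _).1 ?_ |> sub_eq_zero.1
    intro p
    rw [map_sub, ← hR.mul'_map_comul_rightSlice, ← LinearMap.lTensor_comp_rTensor,
      LinearMap.comp_apply, Coalgebra.rTensor_counit_comul, LinearMap.lTensor_tmul,
      LinearMap.mul'_apply, one_mul, apply_rightSlice_eq_apply_leftSlice, sub_self]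
  have h₂ := (hR.isUnit.mul_left_eq_zero).1 h
  have := congr_arg (fun x ↦ leftSlice x (Coalgebra.counit (R := k))) h₂
  simpa [sub_eq_zero] using this

/-- By the antipode axiom applied to the slices of `R`, the element `(S ⊗ I)(R)` is a left inverse
of `R`; triangularity supplies `R₂₁` as a right inverse. -/
theorem IsTriangular.map_antipode (hR : IsTriangular R) :
    TensorProduct.map (HopfAlgebra.antipode k) LinearMap.id R = swap R := by
  refine left_inv_eq_right_inv (a := R) ?_ hR.mul_swap
  refine eq_of_rightSlice_eq fun p ↦ ?_
  rw [rightSlice_map_antipode_mul, ← hR.comul_rightSlice,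
    HopfAlgebra.mul_antipode_rTensor_comul_apply, apply_rightSlice_eq_apply_leftSlice,
    hR.leftSlice_counit, Algebra.TensorProduct.one_def, rightSlice_tmul,
    Algebra.algebraMap_eq_smul_one]

theorem leftSlice_swap (R : A ⊗[k] A) (p : Module.Dual k A) :
    leftSlice (swap R) p = rightSlice R p := by
  simp [leftSlice, swap]

theorem IsTriangular.antipode_rightSlice (hR : IsTriangular R) (p : Module.Dual k A) :
    HopfAlgebra.antipode k (rightSlice R p) = leftSlice R p := by
  have := congr_arg (fun x ↦ rightSlice x p) hR.map_antipode
  rwa [rightSlice_map] at this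

theorem IsTriangular.rightSlice_eq (hR : IsTriangular R) (p : Module.Dual k A) :
    rightSlice R p = leftSlice R (p ∘ₗ HopfAlgebra.antipode k) := by
  rw [← leftSlice_swap, ← hR.map_antipode, leftSlice_map]
  rfl

/-- Each right slice is a left slice by `p ∘ S`, hence the antipode of a right slice. This gives one
inclusion, and finite dimension gives equality, with no appeal to bijectivity of `S`. -/
theorem IsTriangular.map_antipode_range (hR : IsTriangular R) :
    (LinearMap.range (rightSlice R)).map (HopfAlgebra.antipode k (A := A)) =
      LinearMap.range (rightSlice R) := by
  have := finiteDimensional_range_rightSlice R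
  refine (Submodule.eq_of_le_of_finrank_le ?_ (Submodule.finrank_map_le _ _)).symm
  rintro _ ⟨p, rfl⟩
  rw [hR.rightSlice_eq, ← hR.antipode_rightSlice]
  exact Submodule.mem_map_of_mem ⟨_, rfl⟩

theorem IsTriangular.leftSlice_mem (hR : IsTriangular R) (p : Module.Dual k A) :
    leftSlice R p ∈ LinearMap.range (rightSlice R) := by
  rw [← hR.map_antipode_range, ← hR.antipode_rightSlice]
  exact Submodule.mem_map_of_mem ⟨_, rfl⟩

/-- With its mirror image below, this shows that the slices of `R` form a subcoalgebra: contracting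
the comultiplication of a slice gives another slice. -/
theorem IsQuasitriangular.rightSlice_comul_rightSlice (hR : IsQuasitriangular R)
    (p s : Module.Dual k A) :
    rightSlice (Coalgebra.comul (R := k) (rightSlice R p)) s =
      rightSlice R (p ∘ₗ LinearMap.mulRight k (leftSlice R s)) := by
  refine (Module.forall_dual_apply_eq_zero_iff k _).1 ?_ |> sub_eq_zero.1
  intro r
  rw [map_sub, apply_rightSlice, hR.mul'_map_comul_rightSlice, apply_rightSlice_eq_apply_leftSlice]
  simp

theorem IsQuasitriangular.leftSlice_comul_rightSlice (hR : IsQuasitriangular R)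
    (p r : Module.Dual k A) :
    leftSlice (Coalgebra.comul (R := k) (rightSlice R p)) r =
      rightSlice R (p ∘ₗ LinearMap.mulLeft k (leftSlice R r)) := by
  refine (Module.forall_dual_apply_eq_zero_iff k _).1 ?_ |> sub_eq_zero.1
  intro s
  rw [map_sub, apply_leftSlice, hR.mul'_map_comul_rightSlice, apply_rightSlice_eq_apply_leftSlice]
  simp

/-- The subalgebra of first legs of `R`. -/
def IsQuasitriangular.legs (hR : IsQuasitriangular R) : Subalgebra k A :=
  (LinearMap.range (rightSlice R)).toSubalgebra ⟨_, hR.rightSlice_counit⟩ (by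
    rintro _ _ ⟨p, rfl⟩ ⟨q, rfl⟩
    exact ⟨_, (hR.rightSlice_mul p q).symm⟩)

theorem IsTriangular.isSubHopfAlgebra_legs (hR : IsTriangular R) :
    IsSubHopfAlgebra hR.toIsQuasitriangular.legs where
  isSubcoalgebra := by
    rintro _ ⟨p, rfl⟩
    refine mem_range_map_subtype (fun s ↦ ?_) fun r ↦ ?_
    · exact ⟨_, (hR.rightSlice_comul_rightSlice p s).symm⟩
    · exact ⟨_, (hR.leftSlice_comul_rightSlice p r).symm⟩
  antipode_mem := by
    intro c hc
    change _ ∈ LinearMap.range (rightSlice R)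
    rw [← hR.map_antipode_range]
    exact Submodule.mem_map_of_mem hc

theorem IsMinimalTriangular.range_rightSlice (hR : IsMinimalTriangular R) :
    LinearMap.range (rightSlice R) = ⊤ := by
  have := hR.eq_top _ hR.isSubHopfAlgebra_legs
    (mem_range_map_subtype (fun q ↦ ⟨q, rfl⟩) hR.toIsTriangular.leftSlice_mem)
  have h := congr_arg Subalgebra.toSubmodule this
  exact h

theorem IsMinimalTriangular.finiteDimensional (hR : IsMinimalTriangular R) :
    FiniteDimensional k A := by
  have := finiteDimensional_range_rightSlice R
  rw [hR.range_rightSlice] at this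
  exact Module.finite_def.2 ((Submodule.fg_iff_finiteDimensional _).2 this)

/-- The linear isomorphism `p ↦ (I ⊗ p)(R)` from the dual of `A` to `A`. -/
def IsMinimalTriangular.dualEquiv (hR : IsMinimalTriangular R) : Module.Dual k A ≃ₗ[k] A :=
  have := hR.finiteDimensional
  LinearEquiv.ofBijective (rightSlice R)
    ⟨(LinearMap.injective_iff_surjective_of_finrank_eq_finrank Subspace.dual_finrank_eq).2
      (LinearMap.range_eq_top.1 hR.range_rightSlice),
      LinearMap.range_eq_top.1 hR.range_rightSlice⟩

theorem IsMinimalTriangular.dualEquiv_apply (hR : IsMinimalTriangular R) (p : Module.Dual k A) :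
    hR.dualEquiv p = rightSlice R p := rfl

end Quasitriangular

end TriHopf
end

noncomputable section

namespace TriHopf

/-! ### Simple subcoalgebras and grouplike elements. -/

section Pointed

variable {k A : Type*} [Field k] [AddCommGroup A] [Module k A] [Coalgebra k A]

theorem exists_isSimpleSubcoalgebra_le [FiniteDimensional k A] {C : Submodule k A}
    (hC : IsSubcoalgebra C) (h : C ≠ ⊥) : ∃ D ≤ C, IsSimpleSubcoalgebra D := by
  obtain ⟨D, ⟨hD, hD', hDC⟩, hmin⟩ := WellFounded.has_min
    (wellFounded_lt : WellFounded ((· < ·) : Submodule k A → Submodule k A → Prop))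
    {D | IsSubcoalgebra D ∧ D ≠ ⊥ ∧ D ≤ C} ⟨C, hC, h, le_rfl⟩
  refine ⟨D, hDC, hD, hD', fun E hE hED ↦ ?_⟩
  by_contra! hne
  exact hmin E ⟨hE, hne.1, hED.trans hDC⟩ (lt_of_le_of_ne hED hne.2)

theorem exists_isGroupLikeElem_of_finrank_eq_one {D : Submodule k A} (hD : IsSubcoalgebra D)
    (h : Module.finrank k D = 1) : ∃ g ∈ D, IsGroupLikeElem k g := by
  obtain ⟨⟨d, hd⟩, hd0, hspan⟩ := finrank_eq_one_iff'.1 h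
  have hspan' : ∀ x ∈ D, ∃ c : k, c • d = x := fun x hx ↦ by
    obtain ⟨c, hc⟩ := hspan ⟨x, hx⟩
    exact ⟨c, congr_arg Subtype.val hc⟩
  have hd0' : d ≠ 0 := fun h ↦ hd0 (Subtype.ext h)
  obtain ⟨c, hc⟩ : ∃ c : k, Coalgebra.comul (R := k) d = c • d ⊗ₜ[k] d := by
    obtain ⟨x, hx⟩ := hD d hd
    rw [← hx]
    clear hx
    induction x with
    | zero => exact ⟨0, by simp⟩
    | add x y hx hy =>
      obtain ⟨a, ha⟩ := hx
      obtain ⟨b, hb⟩ := hy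
      exact ⟨a + b, by rw [map_add, ha, hb, add_smul]⟩
    | tmul x y =>
      obtain ⟨a, ha⟩ := hspan' x x.2
      obtain ⟨b, hb⟩ := hspan' y y.2
      refine ⟨a * b, ?_⟩
      rw [TensorProduct.map_tmul, Submodule.subtype_apply, Submodule.subtype_apply, ← ha, ← hb,
        TensorProduct.smul_tmul_smul]
  -- Counitality fixes the scalar in `Δ(d) = c d ⊗ d`; rescaling `d` by this `c` makes it grouplike.
  have hε : c * Coalgebra.counit (R := k) d = 1 := by
    have := congr_arg (TensorProduct.lid k A) (Coalgebra.rTensor_counit_comul (R := k) d)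
    simp only [hc, map_smul, LinearMap.rTensor_tmul, TensorProduct.lid_tmul, one_smul,
      smul_smul] at this
    exact smul_left_injective k hd0' (by simpa using this)
  refine ⟨c • d, D.smul_mem _ hd, ?_, ?_⟩
  · simpa using hε
  · rw [map_smul, hc, TensorProduct.smul_tmul_smul, smul_smul]

end Pointed

/-! ### Radicals of artinian and semisimple rings. -/

section Artinian

/-- In an artinian ring, a two-sided ideal which is not comaximal with any proper two-sided ideal
lies in the Jacobson radical. -/
theorem le_jacobson_of_forall_sup_ne_top {A : Type*} [Ring A] [IsArtinianRing A] (J : Ideal A)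
    [J.IsTwoSided] (h : ∀ I : Ideal A, I.IsTwoSided → I ≠ ⊤ → I ⊔ J ≠ ⊤) :
    J ≤ Ring.jacobson A := by
  -- The right annihilator of `J` modulo the radical. If it is everything, then `J` lies in the
  -- radical.
  let I : Ideal A :=
    { carrier := {a | ∀ x ∈ J, x * a ∈ Ring.jacobson A}
      add_mem' := fun ha hb x hx ↦ by
        rw [mul_add]
        exact add_mem (ha x hx) (hb x hx)
      zero_mem' := fun x _ ↦ by
        rw [mul_zero]
        exact zero_mem _
      smul_mem' := fun b a ha x hx ↦ by
        rw [smul_eq_mul, ← mul_assoc]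
        exact ha _ (J.mul_mem_right b hx) }
  have hmem : ∀ a, a ∈ I ↔ ∀ x ∈ J, x * a ∈ Ring.jacobson A := fun _ ↦ Iff.rfl
  have hI : I.IsTwoSided := ⟨fun {a} b ha x hx ↦ by
    rw [← mul_assoc]
    exact Ideal.mul_mem_right b _ (ha x hx)⟩
  by_cases htop : I = ⊤
  · intro x hx
    have : (1 : A) ∈ I := htop ▸ Submodule.mem_top
    simpa using (hmem 1).1 this x hx
  -- Otherwise `I` and `J` turn out to be comaximal. In the semisimple quotient `J` has a
  -- complementary left ideal `L`; writing `1 = j + l`, the products `J l` lie in `J ∩ L = 0`, so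
  -- `l` lifts into `I`.
  refine absurd ?_ (h I hI htop)
  have : IsSemisimpleRing (A ⧸ Ring.jacobson A) := IsSemiprimaryRing.isSemisimpleRing
  obtain ⟨L, hL⟩ := exists_isCompl (J.map (Ideal.Quotient.mk (Ring.jacobson A)))
  have hJmem : ∀ x ∈ J, Ideal.Quotient.mk (Ring.jacobson A) x ∈
    J.map (Ideal.Quotient.mk (Ring.jacobson A)) := fun x hx ↦ Ideal.mem_map_of_mem _ hx
  obtain ⟨j, hj, l, hl, hjl⟩ := Submodule.mem_sup.1
    (hL.sup_eq_top ▸ Submodule.mem_top : (1 : A ⧸ Ring.jacobson A) ∈ _ ⊔ L)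
  obtain ⟨j, hjJ, rfl⟩ := (Ideal.mem_map_iff_of_surjective _ Ideal.Quotient.mk_surjective).1 hj
  obtain ⟨l, rfl⟩ := Ideal.Quotient.mk_surjective l
  have hlI : l ∈ I := fun x hx ↦ by
    rw [← Ideal.Quotient.eq_zero_iff_mem]
    refine (Submodule.mem_bot (A ⧸ Ring.jacobson A)).1 (hL.inf_eq_bot ▸ ⟨?_, ?_⟩)
    · exact hJmem _ (J.mul_mem_right l hx)
    · rw [map_mul]
      exact L.smul_mem _ hl
  have hjac : 1 - (j + l) ∈ Ring.jacobson A := by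
    rw [← Ideal.Quotient.eq_zero_iff_mem, map_sub, map_add, hjl, map_one, sub_self]
  have hjacI : 1 - (j + l) ∈ I := fun x _ ↦ Ideal.mul_mem_left _ x hjac
  rw [Ideal.eq_top_iff_one]
  have : (1 : A) = (1 - (j + l) + l) + j := by abel
  rw [this]
  exact Submodule.add_mem_sup (add_mem hjacI hlI) hjJ

/-- A semisimple ring has no nonzero nil left ideal. -/
theorem eq_zero_of_forall_isNilpotent_mul {K : Type*} [Ring K] [IsSemisimpleRing K] {x : K}
    (h : ∀ y, IsNilpotent (y * x)) : x = 0 := by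
  have : x ∈ Ring.jacobson K := by
    rw [← Ideal.jacobson_bot, Ideal.mem_jacobson_iff]
    intro y
    obtain ⟨u, hu⟩ := (h y).isUnit_one_add
    refine ⟨↑u⁻¹, ?_⟩
    have : (↑u⁻¹ : K) * (1 + y * x) = 1 := by rw [← hu, Units.inv_mul]
    rw [Ideal.mem_bot, ← this]
    noncomm_ring
  rwa [IsSemisimpleRing.jacobson_eq_bot] at this

end Artinian

/-! ### Characters of `A` attached to grouplike elements. -/

section Characters

variable {k A : Type*} [Field k] [Ring A] [HopfAlgebra k A] {R : A ⊗[k] A}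

/-- The character of `A` attached to a grouplike element `g`: it sends `(I ⊗ p)(R)` to `p(g)`. -/
def IsMinimalTriangular.character (hR : IsMinimalTriangular R) (g : GroupLike k A) : A →ₐ[k] k :=
  AlgHom.ofLinearMap (Module.Dual.eval k A g.val ∘ₗ hR.dualEquiv.symm.toLinearMap)
    (by
      have : hR.dualEquiv.symm 1 = Coalgebra.counit := by
        rw [LinearEquiv.symm_apply_eq, hR.dualEquiv_apply, hR.rightSlice_counit]
      simp [this])
    (by
      intro a b
      obtain ⟨p, rfl⟩ := hR.dualEquiv.surjective a
      obtain ⟨q, rfl⟩ := hR.dualEquiv.surjective b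
      -- The order is reversed, which is harmless because the character takes values in the
      -- commutative field `k`.
      have : hR.dualEquiv.symm (hR.dualEquiv p * hR.dualEquiv q) = convDual q p := by
        rw [LinearEquiv.symm_apply_eq, hR.dualEquiv_apply, hR.dualEquiv_apply, hR.dualEquiv_apply,
          hR.rightSlice_mul]
      simp [this, convDual, mul_comm])

theorem IsMinimalTriangular.character_rightSlice (hR : IsMinimalTriangular R) (g : GroupLike k A)
    (p : Module.Dual k A) : hR.character g (rightSlice R p) = p g.val := by
  rw [← hR.dualEquiv_apply]
  simp [character]

/-- Contracting the first leg of `R` with `χ_g` returns `g`, so the convolution of `χ_g` and `χ_h`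
sends the slice by `p` to `p(gh)`. -/
theorem IsMinimalTriangular.character_mul (hR : IsMinimalTriangular R) (g h : GroupLike k A)
    (a : A) : LinearMap.mul' k k (TensorProduct.map (hR.character g).toLinearMap
      (hR.character h).toLinearMap (Coalgebra.comul (R := k) a)) = hR.character (g * h) a := by
  obtain ⟨p, rfl⟩ := hR.dualEquiv.surjective a
  have key : ∀ g : GroupLike k A, leftSlice R (hR.character g).toLinearMap = g.val := fun g ↦ by
    refine (Module.forall_dual_apply_eq_zero_iff k _).1 ?_ |> sub_eq_zero.1
    intro q
    rw [map_sub, ← apply_rightSlice_eq_apply_leftSlice, AlgHom.toLinearMap_apply,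
      hR.character_rightSlice, sub_self]
  rw [hR.dualEquiv_apply, hR.mul'_map_comul_rightSlice, hR.character_rightSlice, key, key]
  rfl

theorem IsMinimalTriangular.character_one (hR : IsMinimalTriangular R) (a : A) :
    hR.character 1 a = Coalgebra.counit (R := k) a := by
  obtain ⟨p, rfl⟩ := hR.dualEquiv.surjective a
  rw [hR.dualEquiv_apply, hR.character_rightSlice, apply_rightSlice_eq_apply_leftSlice,
    hR.leftSlice_counit]
  rfl

/-- In a pointed minimal triangular Hopf algebra, every proper two-sided ideal is killed by a
character attached to a grouplike element. -/
theorem IsMinimalTriangular.exists_le_ker_character (hA : IsPointed k A)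
    (hR : IsMinimalTriangular R) (I : Ideal A) [I.IsTwoSided] (hI : I ≠ ⊤) :
    ∃ g, I ≤ RingHom.ker (hR.character g) := by
  have := hR.finiteDimensional
  -- `W` is a two-sided ideal for convolution, because slicing reverses products. Its annihilator
  -- `C` in `A` is therefore a subcoalgebra.
  let W : Submodule k (Module.Dual k A) := (I.restrictScalars k).comap hR.dualEquiv.toLinearMap
  have hW : ∀ p, p ∈ W ↔ rightSlice R p ∈ I := fun p ↦ Iff.rfl
  let C : Submodule k A := W.dualCoannihilator
  have hCmem : ∀ a, a ∈ C ↔ ∀ p ∈ W, p a = 0 := fun a ↦ Submodule.mem_dualCoannihilator a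
  have hC : IsSubcoalgebra C := by
    intro c hc
    rw [hCmem] at hc
    refine mem_range_map_subtype (fun q ↦ ?_) fun p ↦ ?_
    · rw [hCmem]
      intro p hp
      rw [apply_rightSlice]
      refine hc (convDual p q) ?_
      rw [hW, ← hR.rightSlice_mul]
      exact I.mul_mem_left _ hp
    · rw [hCmem]
      intro q hq
      rw [apply_leftSlice]
      refine hc (convDual p q) ?_
      rw [hW, ← hR.rightSlice_mul]
      exact I.mul_mem_right _ hq
  -- In finite dimension a subspace of the dual with zero annihilator is everything, which would put
  -- `1` in `I`.
  have hC0 : C ≠ ⊥ := by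
    intro h
    apply hI
    have hWtop : W = ⊤ := by
      rw [← Subspace.dualCoannihilator_dualAnnihilator_eq (W := W)]
      change C.dualAnnihilator = ⊤
      rw [h, Submodule.dualAnnihilator_bot]
    rw [Ideal.eq_top_iff_one]
    obtain ⟨p, hp⟩ := hR.dualEquiv.surjective 1
    rw [← hp]
    exact (hW p).1 (hWtop ▸ Submodule.mem_top)
  -- Pointedness enters here: `C` contains a grouplike `g`, and `g ∈ C` says exactly that `χ_g`
  -- kills `I`.
  obtain ⟨D, hDC, hD⟩ := exists_isSimpleSubcoalgebra_le hC hC0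
  obtain ⟨g, hgD, hg⟩ := exists_isGroupLikeElem_of_finrank_eq_one hD.1 (hA D hD)
  refine ⟨⟨g, hg⟩, fun a ha ↦ ?_⟩
  obtain ⟨p, rfl⟩ := hR.dualEquiv.surjective a
  rw [RingHom.mem_ker, hR.dualEquiv_apply, hR.character_rightSlice]
  exact (hCmem g).1 (hDC hgD) p ha

/-- Elements killed by all characters attached to grouplike elements are in the radical. -/
theorem IsMinimalTriangular.isNilpotent_of_character_eq_zero (hA : IsPointed k A)
    (hR : IsMinimalTriangular R) {a : A} (ha : ∀ g, hR.character g a = 0) : IsNilpotent a := by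
  have := hR.finiteDimensional
  have : IsArtinianRing A := IsArtinianRing.of_finite k A
  let J : Ideal A := ⨅ g, RingHom.ker (hR.character g)
  have hJmem : ∀ a, a ∈ J ↔ ∀ g, hR.character g a = 0 := by
    intro a
    simp [J, RingHom.mem_ker]
  have hJ : J.IsTwoSided := ⟨fun {a} b ha ↦ by
    rw [hJmem] at ha ⊢
    intro g
    rw [map_mul, ha, zero_mul]⟩
  -- A proper two-sided ideal and `J` lie together in some `ker χ_g`, so they are never comaximal.
  have hle : J ≤ Ring.jacobson A := by
    refine le_jacobson_of_forall_sup_ne_top J fun I hI hne ↦ ?_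
    obtain ⟨g, hg⟩ := hR.exists_le_ker_character hA I hne
    intro htop
    have h1 : (1 : A) ∈ RingHom.ker (hR.character g) :=
      (sup_le hg (iInf_le _ g) : I ⊔ J ≤ _) (htop ▸ Submodule.mem_top)
    rw [RingHom.mem_ker, map_one] at h1
    exact one_ne_zero h1
  obtain ⟨n, hn⟩ := (IsSemiprimaryRing.isNilpotent : IsNilpotent (Ring.jacobson A))
  refine ⟨n, ?_⟩
  have := Ideal.pow_mem_pow (hle ((hJmem a).2 ha)) n
  rwa [hn] at this

end Characters

/-! ### The projection onto the group algebra. -/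

section Projection

variable {k A : Type*} [Field k] [Ring A] [HopfAlgebra k A] {R : A ⊗[k] A}

theorem groupLikeIncl_single (g : GroupLike k A) (c : k) :
    groupLikeIncl k A (MonoidAlgebra.single g c) = c • g.val := by
  simp [groupLikeIncl]

theorem groupLikeIncl_injective : Function.Injective (groupLikeIncl k A) := by
  have h : (groupLikeIncl k A : GroupLikeAlgebra k A → A) =
      fun x ↦ Finsupp.linearCombination k (GroupLike.val (R := k) (A := A)) x.coeff := by
    ext x
    induction x using MonoidAlgebra.induction_linear with
    | zero => simp
    | add x y hx hy => simp [hx, hy]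
    | single g c => simp [groupLikeIncl_single]
  rw [h]
  exact Function.Injective.comp (linearIndep_groupLikeVal (R := k) (A := A))
    MonoidAlgebra.coeff_injective

theorem finite_groupLike [FiniteDimensional k A] : Finite (GroupLike k A) :=
  (linearIndep_groupLikeVal (R := k) (A := A)).finite

/-- All characters attached to grouplike elements, together. -/
def IsMinimalTriangular.characters (hR : IsMinimalTriangular R) : A →ₐ[k] (GroupLike k A → k) :=
  AlgHom.pi hR.character

/-- If all `χ_g` kill `x ∈ k[G]`, they kill the left ideal generated by `x`, which is then nil and
so zero by semisimplicity. Both sides have dimension `|G|`. -/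
theorem IsMinimalTriangular.characters_groupLikeIncl_bijective [CharZero k] (hA : IsPointed k A)
    (hR : IsMinimalTriangular R) : Function.Bijective
      (hR.characters.comp (groupLikeIncl k A : GroupLikeAlgebra k A →ₐ[k] A)) := by
  have := hR.finiteDimensional
  have hfin := finite_groupLike (k := k) (A := A)
  have : Fintype (GroupLike k A) := Fintype.ofFinite _
  -- Maschke's condition, making the group algebra semisimple; this is the use of characteristic
  -- zero.
  have : NeZero (Nat.card (GroupLike k A) : k) := ⟨by simp⟩
  have hinj : Function.Injective
      (hR.characters.comp (groupLikeIncl k A : GroupLikeAlgebra k A →ₐ[k] A)) := by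
    rw [injective_iff_map_eq_zero]
    intro x hx
    refine eq_zero_of_forall_isNilpotent_mul fun y ↦ ?_
    have h : IsNilpotent (groupLikeIncl k A (y * x)) := by
      refine hR.isNilpotent_of_character_eq_zero hA fun g ↦ ?_
      have hg := congr_fun hx g
      change hR.character g (groupLikeIncl k A x) = 0 at hg
      rw [map_mul, map_mul, hg, mul_zero]
    exact (IsNilpotent.map_iff groupLikeIncl_injective).1 h
  refine ⟨hinj, ?_⟩
  have e : GroupLikeAlgebra k A ≃ₗ[k] (GroupLike k A →₀ k) := MonoidAlgebra.coeffLinearEquiv k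
  have : Module.Finite k (GroupLikeAlgebra k A) := Module.Finite.equiv e.symm
  refine (LinearMap.injective_iff_surjective_of_finrank_eq_finrank
    (f := (hR.characters.comp (groupLikeIncl k A : GroupLikeAlgebra k A →ₐ[k] A)).toLinearMap)
    ?_).1 hinj
  rw [e.finrank_eq]
  simp

/-- The projection of a pointed minimal triangular Hopf algebra onto the group algebra of its
grouplike elements, as a map of algebras. -/
def IsMinimalTriangular.projAlgHom [CharZero k] (hA : IsPointed k A)
    (hR : IsMinimalTriangular R) : A →ₐ[k] GroupLikeAlgebra k A :=
  (AlgEquiv.ofBijective _ (hR.characters_groupLikeIncl_bijective hA)).symm.toAlgHom.comp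
    hR.characters

theorem IsMinimalTriangular.character_groupLikeIncl_projAlgHom [CharZero k] (hA : IsPointed k A)
    (hR : IsMinimalTriangular R) (g : GroupLike k A) (a : A) :
    hR.character g (groupLikeIncl k A (hR.projAlgHom hA a)) = hR.character g a :=
  congr_fun ((AlgEquiv.ofBijective _ (hR.characters_groupLikeIncl_bijective hA)).apply_symm_apply
    (hR.characters a)) g

theorem IsMinimalTriangular.groupLikeAlgebra_ext [CharZero k] (hA : IsPointed k A)
    (hR : IsMinimalTriangular R) {x y : GroupLikeAlgebra k A}
    (h : ∀ g, hR.character g (groupLikeIncl k A x) = hR.character g (groupLikeIncl k A y)) :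
    x = y :=
  (hR.characters_groupLikeIncl_bijective hA).1 (funext h)

/-- The restricted characters have zero common kernel, so in finite dimension they span the dual.
This reduces identities in `K ⊗ K` to tests against pairs of characters. -/
theorem IsMinimalTriangular.mem_span_character [CharZero k] (hA : IsPointed k A)
    (hR : IsMinimalTriangular R) (p : Module.Dual k (GroupLikeAlgebra k A)) :
    p ∈ Submodule.span k (Set.range fun g ↦
      (hR.character g).toLinearMap ∘ₗ (groupLikeIncl k A : _ →ₗ[k] A)) := by
  have := hR.finiteDimensional
  have hfin := finite_groupLike (k := k) (A := A)
  have e : GroupLikeAlgebra k A ≃ₗ[k] (GroupLike k A →₀ k) := MonoidAlgebra.coeffLinearEquiv k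
  have : Module.Finite k (GroupLikeAlgebra k A) := Module.Finite.equiv e.symm
  rw [← Subspace.dualCoannihilator_dualAnnihilator_eq (W := Submodule.span k _),
    Submodule.mem_dualAnnihilator]
  intro x hx
  have : x = 0 := hR.groupLikeAlgebra_ext hA fun g ↦ by
    rw [map_zero, map_zero]
    exact (Submodule.mem_dualCoannihilator x).1 hx _ (Submodule.subset_span ⟨g, rfl⟩)
  rw [this, map_zero]

theorem IsMinimalTriangular.groupLikeAlgebra_tensor_ext [CharZero k] (hA : IsPointed k A)
    (hR : IsMinimalTriangular R) {x y : GroupLikeAlgebra k A ⊗[k] GroupLikeAlgebra k A}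
    (h : ∀ g h, LinearMap.mul' k k (TensorProduct.map
        ((hR.character g).toLinearMap ∘ₗ (groupLikeIncl k A : _ →ₗ[k] A))
        ((hR.character h).toLinearMap ∘ₗ (groupLikeIncl k A : _ →ₗ[k] A)) x) =
      LinearMap.mul' k k (TensorProduct.map
        ((hR.character g).toLinearMap ∘ₗ (groupLikeIncl k A : _ →ₗ[k] A))
        ((hR.character h).toLinearMap ∘ₗ (groupLikeIncl k A : _ →ₗ[k] A)) y)) :
    x = y := by
  refine eq_of_forall_dual fun p q ↦ ?_
  induction hR.mem_span_character hA p using Submodule.span_induction with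
  | zero => simp
  | add p p' _ _ hp hp' =>
    simp only [TensorProduct.map_add_left, LinearMap.add_apply, map_add, hp, hp']
  | smul c p _ hp => simp only [TensorProduct.map_smul_left, LinearMap.smul_apply, map_smul, hp]
  | mem p hp =>
    obtain ⟨g, rfl⟩ := hp
    induction hR.mem_span_character hA q using Submodule.span_induction with
    | zero => simp
    | add p p' _ _ hp hp' =>
      simp only [TensorProduct.map_add_right, LinearMap.add_apply, map_add, hp, hp']
    | smul c p _ hp => simp only [TensorProduct.map_smul_right, LinearMap.smul_apply, map_smul, hp]
    | mem q hq =>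
      obtain ⟨g', rfl⟩ := hq
      exact h g g'

/-- The projection of a pointed minimal triangular Hopf algebra onto the group algebra of its
grouplike elements. -/
def IsMinimalTriangular.proj [CharZero k] (hA : IsPointed k A)
    (hR : IsMinimalTriangular R) : A →ₐc[k] GroupLikeAlgebra k A :=
  BialgHom.ofAlgHom (hR.projAlgHom hA)
    (by
      ext a
      change Coalgebra.counit (R := k) (hR.projAlgHom hA a) = Coalgebra.counit (R := k) a
      rw [← CoalgHomClass.counit_comp_apply (groupLikeIncl k A), ← hR.character_one,
        ← hR.character_one, hR.character_groupLikeIncl_projAlgHom])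
    (by
      ext a
      change TensorProduct.map (hR.projAlgHom hA).toLinearMap (hR.projAlgHom hA).toLinearMap
        (Coalgebra.comul a) = Coalgebra.comul (R := k) (hR.projAlgHom hA a)
      refine hR.groupLikeAlgebra_tensor_ext hA fun g h ↦ ?_
      -- As `χ_g ∘ i ∘ π = χ_g`, testing either side of comultiplicativity against `χ_g ⊗ χ_h` gives
      -- `χ_{gh}(a)`.
      have key : ∀ g, ((hR.character g).toLinearMap ∘ₗ (groupLikeIncl k A : _ →ₗ[k] A)) ∘ₗ
          (hR.projAlgHom hA).toLinearMap = (hR.character g).toLinearMap := fun g ↦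
        LinearMap.ext fun a ↦ hR.character_groupLikeIncl_projAlgHom hA g a
      rw [← LinearMap.comp_apply (TensorProduct.map _ _), ← TensorProduct.map_comp, key, key,
        hR.character_mul, TensorProduct.map_comp, LinearMap.comp_apply,
        CoalgHomClass.map_comp_comul_apply (groupLikeIncl k A)]
      exact ((hR.character_mul g h _).trans
        (hR.character_groupLikeIncl_projAlgHom hA (g * h) a)).symm)

theorem IsMinimalTriangular.proj_groupLikeIncl [CharZero k] (hA : IsPointed k A)
    (hR : IsMinimalTriangular R) (x : GroupLikeAlgebra k A) :
    hR.proj hA (groupLikeIncl k A x) = x :=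
  hR.groupLikeAlgebra_ext hA fun g ↦ hR.character_groupLikeIncl_projAlgHom hA g _

theorem IsMinimalTriangular.character_groupLikeIncl_proj [CharZero k] (hA : IsPointed k A)
    (hR : IsMinimalTriangular R) (g : GroupLike k A) (a : A) :
    hR.character g (groupLikeIncl k A (hR.proj hA a)) = hR.character g a :=
  hR.character_groupLikeIncl_projAlgHom hA g a

end Projection

end TriHopf
end

noncomputable section

namespace TriHopf

/-! ### The antipode, comultiplication and Hopf algebra maps. -/

section Antipode

open HopfAlgebra Coalgebra

variable {k A : Type*} [Field k] [Ring A] [HopfAlgebra k A]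

theorem antipode_tmul_one_mul_comul (w : A) :
    LinearMap.mul' k (A ⊗[k] A) (TensorProduct.map
      ((Algebra.TensorProduct.includeLeft : A →ₐ[k] A ⊗[k] A).toLinearMap ∘ₗ antipode k)
      comul (comul (R := k) w)) = (1 : A) ⊗ₜ[k] w := by
  have key : ∀ y : A ⊗[k] A, LinearMap.mul' k (A ⊗[k] A) (TensorProduct.map
      ((Algebra.TensorProduct.includeLeft : A →ₐ[k] A ⊗[k] A).toLinearMap ∘ₗ antipode k)
      comul y) = (LinearMap.mul' k A ∘ₗ (antipode k).rTensor A).rTensor A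
        ((TensorProduct.assoc k A A A).symm ((comul (R := k)).lTensor A y)) := by
    intro y
    induction y with
    | zero => simp
    | add y z hy hz => simp only [map_add, hy, hz]
    | tmul a b =>
      simp only [TensorProduct.map_tmul, LinearMap.lTensor_tmul, LinearMap.mul'_apply]
      induction comul (R := k) b with
      | zero => simp
      | add y z hy hz => simp only [map_add, mul_add, TensorProduct.tmul_add, hy, hz]
      | tmul c d => simp
  rw [key, coassoc_symm_apply]
  have key₂ : ∀ y : A ⊗[k] A, (LinearMap.mul' k A ∘ₗ (antipode k).rTensor A).rTensor A
      ((comul (R := k)).rTensor A y) = (Algebra.linearMap k A).rTensor A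
        ((counit (R := k)).rTensor A y) := by
    intro y
    induction y with
    | zero => simp
    | add y z hy hz => simp only [map_add, hy, hz]
    | tmul a b => simp
  rw [key₂, rTensor_counit_comul]
  simp

/-- Both sides are convolution inverses of `Δ` among linear maps `A → A ⊗ A`, one on the left and
one on the right. -/
theorem comul_antipode (a : A) :
    comul (R := k) (antipode k a) = TensorProduct.map (antipode k) (antipode k)
      (TensorProduct.comm k A A (comul (R := k) a)) := by
  have h : WithConv.toConv ((TensorProduct.map (antipode k) (antipode k)) ∘ₗ
      (TensorProduct.comm k A A).toLinearMap ∘ₗ comul (R := k)) *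
      WithConv.toConv (comul (R := k) (A := A)) = 1 := by
    ext a
    rw [LinearMap.convMul_apply, LinearMap.convOne_apply]
    -- `F(a ⊗ b ⊗ c) = (1 ⊗ S(a)) (S(b) ⊗ 1) Δ(c)`. After coassociativity the last two factors
    -- collapse to `1 ⊗ a₂`, leaving `1 ⊗ S(a₁) a₂`.
    let F : A ⊗[k] (A ⊗[k] A) →ₗ[k] A ⊗[k] A := LinearMap.mul' k (A ⊗[k] A) ∘ₗ TensorProduct.map
      ((Algebra.TensorProduct.includeRight : A →ₐ[k] A ⊗[k] A).toLinearMap ∘ₗ antipode k)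
      (LinearMap.mul' k (A ⊗[k] A) ∘ₗ TensorProduct.map
        ((Algebra.TensorProduct.includeLeft : A →ₐ[k] A ⊗[k] A).toLinearMap ∘ₗ antipode k)
        (comul (R := k)))
    have hF : ∀ y : A ⊗[k] A, LinearMap.mul' k (A ⊗[k] A) (TensorProduct.map
        ((TensorProduct.map (antipode k) (antipode k)) ∘ₗ
          (TensorProduct.comm k A A).toLinearMap ∘ₗ comul (R := k)) comul y) =
        F (TensorProduct.assoc k A A A ((comul (R := k)).rTensor A y)) := by
      intro y
      induction y with
      | zero => simp
      | add y z hy hz => simp only [map_add, hy, hz]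
      | tmul a b =>
        simp only [TensorProduct.map_tmul, LinearMap.rTensor_tmul, LinearMap.mul'_apply,
          LinearMap.comp_apply, LinearEquiv.coe_coe]
        induction comul (R := k) a with
        | zero => simp
        | add y z hy hz => simp only [map_add, add_mul, TensorProduct.add_tmul, hy, hz]
        | tmul c d => simp [F, ← mul_assoc]
    have hF' : ∀ y : A ⊗[k] A, F ((comul (R := k)).lTensor A y) =
        (1 : A) ⊗ₜ[k] LinearMap.mul' k A ((antipode k).rTensor A y) := by
      intro y
      induction y with
      | zero => simp
      | add y z hy hz => simp only [map_add, hy, hz, TensorProduct.tmul_add]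
      | tmul a b =>
        simp only [F, LinearMap.lTensor_tmul, LinearMap.comp_apply, TensorProduct.map_tmul,
          antipode_tmul_one_mul_comul, LinearMap.mul'_apply]
        simp
    change LinearMap.mul' k (A ⊗[k] A) (TensorProduct.map
        ((TensorProduct.map (antipode k) (antipode k)) ∘ₗ
          (TensorProduct.comm k A A).toLinearMap ∘ₗ comul (R := k)) comul (comul a)) = _
    rw [hF, coassoc_apply, hF', mul_antipode_rTensor_comul_apply]
    simp [Algebra.algebraMap_eq_smul_one, Algebra.TensorProduct.one_def]
  have := left_inv_eq_right_inv h LinearMap.comul_right_inv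
  exact (LinearMap.congr_fun (congr_arg WithConv.ofConv this) a).symm

/-- `π ∘ S` and `S ∘ π` are a left and a right convolution inverse of `π`. -/
theorem map_antipode_bialgHom {K : Type*} [Ring K] [HopfAlgebra k K] (π : A →ₐc[k] K) (a : A) :
    π (antipode k a) = antipode k (π a) := by
  have h₁ : WithConv.toConv ((π : A →ₗ[k] K) ∘ₗ antipode k) * WithConv.toConv (π : A →ₗ[k] K) = 1 := by
    ext a
    rw [LinearMap.convMul_apply, LinearMap.convOne_apply]
    have key : ∀ y : A ⊗[k] A, LinearMap.mul' k K (TensorProduct.map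
        ((π : A →ₗ[k] K) ∘ₗ antipode k) (π : A →ₗ[k] K) y) =
        π (LinearMap.mul' k A ((antipode k).rTensor A y)) := by
      intro y
      induction y with
      | zero => simp
      | add y z hy hz => simp only [map_add, hy, hz]
      | tmul a b => simp
    refine (key _).trans ?_
    rw [mul_antipode_rTensor_comul_apply]
    exact AlgHomClass.commutes π _
  have h₂ : WithConv.toConv (π : A →ₗ[k] K) * WithConv.toConv (antipode k ∘ₗ (π : A →ₗ[k] K)) = 1 := by
    ext a
    rw [LinearMap.convMul_apply, LinearMap.convOne_apply]
    have key : ∀ y : A ⊗[k] A, LinearMap.mul' k K (TensorProduct.map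
        (π : A →ₗ[k] K) (antipode k ∘ₗ (π : A →ₗ[k] K)) y) =
        LinearMap.mul' k K ((antipode k).lTensor K (TensorProduct.map (π : A →ₗ[k] K) π y)) := by
      intro y
      induction y with
      | zero => simp
      | add y z hy hz => simp only [map_add, hy, hz]
      | tmul a b => simp
    refine (key _).trans ?_
    rw [CoalgHomClass.map_comp_comul_apply, mul_antipode_lTensor_comul_apply,
      CoalgHomClass.counit_comp_apply]
  exact LinearMap.congr_fun (congr_arg WithConv.ofConv (left_inv_eq_right_inv h₁ h₂)) a

end Antipode

end TriHopf
end

noncomputable section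

namespace TriHopf

/-! ### The Drinfeld element of a triangular Hopf algebra is grouplike. -/

section Drinfeld

open HopfAlgebra Coalgebra

variable {k A : Type*} [Field k] [Ring A] [HopfAlgebra k A]

variable (k A) in
/-- The contraction `a ⊗ b ↦ S(b) a`, which sends `R` to its Drinfeld element. -/
def antipodeContract : A ⊗[k] A →ₗ[k] A :=
  LinearMap.mul' k A ∘ₗ (antipode k).rTensor A ∘ₗ (TensorProduct.comm k A A).toLinearMap

@[simp]
theorem antipodeContract_tmul (a b : A) : antipodeContract k A (a ⊗ₜ[k] b) = antipode k b * a := by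
  simp [antipodeContract]

theorem drinfeldElement_eq (R : A ⊗[k] A) : drinfeldElement R = antipodeContract k A R := rfl

theorem antipodeContract_mul (t y : A ⊗[k] A) : antipodeContract k A (t * y) =
    LinearMap.mul' k A (TensorProduct.map (antipode k)
      (LinearMap.mulLeft k (antipodeContract k A t)) (TensorProduct.comm k A A y)) := by
  induction y with
  | zero => simp
  | add y z hy hz => simp only [mul_add, map_add, hy, hz]
  | tmul c d =>
    induction t with
    | zero => simp
    | add t t' ht ht' =>
      rw [add_mul, map_add, ht, ht', map_add]
      simp [mul_add, add_mul]
    | tmul a b => simp [antipode_mul_antidistrib, mul_assoc]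

theorem antipodeContract_swap_mul (y t : A ⊗[k] A) (c : k)
    (h : LinearMap.mul' k A ((antipode k).rTensor A y) = algebraMap k A c) :
    antipodeContract k A (swap y * t) = c • antipodeContract k A t := by
  have key : ∀ a b : A, antipodeContract k A (swap y * a ⊗ₜ[k] b) =
      antipode k b * LinearMap.mul' k A ((antipode k).rTensor A y) * a := by
    intro a b
    clear h
    induction y with
    | zero => simp [swap]
    | add y z hy hz =>
      simp only [swap, map_add, add_mul, mul_add] at *
      rw [hy, hz]
    | tmul c d => simp [swap, antipode_mul_antidistrib, mul_assoc]
  induction t with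
  | zero => simp
  | add t t' ht ht' => simp only [mul_add, map_add, ht, ht', smul_add]
  | tmul a b =>
    rw [key, h, Algebra.algebraMap_eq_smul_one]
    simp

variable {R : A ⊗[k] A}

/-- Apply `a ⊗ b ↦ S(b) a` to `Δᶜᵒᵖ(x) R = R Δ(x)`: one side becomes `S(x₂) u x₁`, and on the other
`S(x₁) x₂` collapses to the counit. -/
theorem IsQuasitriangular.antipode_mul_drinfeldElement_mul (hR : IsQuasitriangular R) (x : A) :
    LinearMap.mul' k A (TensorProduct.map (antipode k) (LinearMap.mulLeft k (drinfeldElement R))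
      (TensorProduct.comm k A A (comul (R := k) x))) = counit (R := k) x • drinfeldElement R := by
  rw [drinfeldElement_eq, ← antipodeContract_mul, ← hR.swap_comul_mul]
  exact antipodeContract_swap_mul _ _ _ (mul_antipode_rTensor_comul_apply x)

/-- The square of the antipode is implemented by the Drinfeld element. -/
theorem IsQuasitriangular.drinfeldElement_mul (hR : IsQuasitriangular R) (x : A) :
    drinfeldElement R * x = antipode k (antipode k x) * drinfeldElement R := by
  -- `F` sends the iterated coproduct of `x` to `S(x₂ S(x₃)) u x₁`. Collapsing `x₂ S(x₃)` gives `u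
  -- x`; expanding to `S²(x₃) S(x₂) u x₁` gives `S²(x) u`.
  let F : A ⊗[k] (A ⊗[k] A) →ₗ[k] A := LinearMap.mul' k A ∘ₗ TensorProduct.map
    (antipode k ∘ₗ LinearMap.mul' k A ∘ₗ (antipode k).lTensor A)
    (LinearMap.mulLeft k (drinfeldElement R)) ∘ₗ (TensorProduct.comm k A (A ⊗[k] A)).toLinearMap
  have h₁ : ∀ y : A ⊗[k] A, F (comul.lTensor A y) =
      drinfeldElement R * TensorProduct.rid k A ((counit (R := k)).lTensor A y) := by
    intro y
    induction y with
    | zero => simp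
    | add y z hy hz => simp only [map_add, hy, hz, mul_add]
    | tmul a b => simp [F, Algebra.algebraMap_eq_smul_one]
  have h₂ : ∀ y : A ⊗[k] A, F (TensorProduct.assoc k A A A (comul.rTensor A y)) =
      antipode k (antipode k (TensorProduct.lid k A ((counit (R := k)).rTensor A y))) *
        drinfeldElement R := by
    intro y
    induction y with
    | zero => simp
    | add y z hy hz => simp only [map_add, hy, hz, add_mul]
    | tmul a b =>
      have : ∀ y : A ⊗[k] A, F (TensorProduct.assoc k A A A (y ⊗ₜ b)) =
          antipode k (antipode k b) * LinearMap.mul' k A (TensorProduct.map (antipode k)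
            (LinearMap.mulLeft k (drinfeldElement R)) (TensorProduct.comm k A A y)) := by
        intro y
        induction y with
        | zero => simp
        | add y z hy hz => simp only [map_add, hy, hz, mul_add, TensorProduct.add_tmul]
        | tmul c d => simp [F, antipode_mul_antidistrib, mul_assoc]
      rw [LinearMap.rTensor_tmul, this, hR.antipode_mul_drinfeldElement_mul]
      simp
  have h := h₂ (comul x)
  rw [coassoc_apply, h₁, rTensor_counit_comul, lTensor_counit_comul] at h
  simpa using h

theorem IsTriangular.map_antipode_antipode (hR : IsTriangular R) :
    TensorProduct.map (antipode k) (antipode k) R = R := by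
  have h : ∀ x : A ⊗[k] A, TensorProduct.map (antipode k) (antipode k) x =
      swap (TensorProduct.map (antipode k) LinearMap.id
        (swap (TensorProduct.map (antipode k) LinearMap.id x))) := by
    intro x
    induction x with
    | zero => simp [swap]
    | add x y hx hy => rw [map_add, hx, hy]; simp [swap]
    | tmul a b => simp [swap]
  have hs : swap (swap R) = R := (TensorProduct.comm k A A).symm_apply_apply R
  rw [h, hR.map_antipode, hs, hR.map_antipode, hs]

theorem IsTriangular.counit_drinfeldElement (hR : IsTriangular R) :
    counit (R := k) (drinfeldElement R) = 1 := by
  have h : ∀ x : A ⊗[k] A, counit (R := k) (antipodeContract k A x) =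
      counit (R := k) (rightSlice x (counit (R := k))) := by
    intro x
    induction x with
    | zero => simp
    | add x y hx hy => simp only [map_add, LinearMap.add_apply, hx, hy]
    | tmul a b => simp
  rw [drinfeldElement_eq, h, hR.rightSlice_counit, Bialgebra.counit_one]

/-- Writing `R = ∑ a ⊗ b`, the left side is `∑ S(b) a₁ ⊗ a₂`. The identity for `(Δ ⊗ I)(R)` splits
`b` into a product, and one of the two copies of `R` contracts to `u`. -/
theorem IsTriangular.antipode_tmul_one_mul_comul_legs (hR : IsTriangular R) :
    LinearMap.mul' k (A ⊗[k] A) (TensorProduct.map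
      ((Algebra.TensorProduct.includeLeft : A →ₐ[k] A ⊗[k] A).toLinearMap ∘ₗ antipode k) comul
        (swap R)) =
      TensorProduct.map (antipode k) LinearMap.id (swap R) * drinfeldElement R ⊗ₜ[k] (1 : A) := by
  let G : A ⊗[k] (A ⊗[k] A) →ₗ[k] A ⊗[k] A := (antipodeContract k A).rTensor A ∘ₗ
    (TensorProduct.assoc k A A A).symm.toLinearMap ∘ₗ
    (TensorProduct.comm k A A).toLinearMap.lTensor A
  have h₁ : ∀ x : A ⊗[k] A, LinearMap.mul' k (A ⊗[k] A) (TensorProduct.map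
      ((Algebra.TensorProduct.includeLeft : A →ₐ[k] A ⊗[k] A).toLinearMap ∘ₗ antipode k) comul
        (swap x)) = G (TensorProduct.assoc k A A A (comul.rTensor A x)) := by
    intro x
    induction x with
    | zero => simp [swap]
    | add x y hx hy => simp only [swap, map_add] at *; rw [hx, hy]
    | tmul a b =>
      simp only [swap, TensorProduct.comm_tmul, TensorProduct.map_tmul, LinearMap.rTensor_tmul,
        LinearMap.mul'_apply]
      induction comul (R := k) a with
      | zero => simp
      | add y z hy hz => simp only [map_add, mul_add, TensorProduct.add_tmul, hy, hz]
      | tmul c d => simp [G]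
  have h₂ : ∀ x y : A ⊗[k] A, G (leg13 x * leg23 y) =
      TensorProduct.map (antipode k) LinearMap.id (swap y) *
        antipodeContract k A x ⊗ₜ[k] (1 : A) := by
    intro x y
    induction x with
    | zero => simp [leg13]
    | add x x' hx hx' =>
      simp only [leg13, map_add, add_mul, TensorProduct.add_tmul, mul_add] at *
      rw [hx, hx']
    | tmul a b =>
      induction y with
      | zero => simp [leg23, swap]
      | add y y' hy hy' =>
        simp only [leg23, swap, map_add, add_mul, TensorProduct.tmul_add, mul_add] at *
        rw [hy, hy']
      | tmul c d => simp [G, leg13, leg23, swap, antipode_mul_antidistrib, mul_assoc]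
  rw [h₁, hR.comul_left, h₂, drinfeldElement_eq]

/-- Expanding `Δ(S(b) a)` by `(I ⊗ Δ)(R) = R₁₃ R₁₂` produces one factor `u ⊗ 1`, which is moved to
the far right. Expanding the other copy of `R` by `(Δ ⊗ I)(R) = R₁₃ R₂₃` leaves a factor built from
`R R₂₁ = 1`, and what survives is `(1 ⊗ u)(u ⊗ 1)`. -/
theorem IsTriangular.comul_drinfeldElement (hR : IsTriangular R) :
    comul (R := k) (drinfeldElement R) = drinfeldElement R ⊗ₜ[k] drinfeldElement R := by
  let X : A ⊗[k] A → A ⊗[k] A := fun x ↦ LinearMap.mul' k (A ⊗[k] A) (TensorProduct.map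
    ((Algebra.TensorProduct.includeLeft : A →ₐ[k] A ⊗[k] A).toLinearMap ∘ₗ antipode k) comul
      (swap x))
  let W : A ⊗[k] A := TensorProduct.map (antipode k) LinearMap.id (swap R)
  let G : A ⊗[k] (A ⊗[k] A) →ₗ[k] A ⊗[k] A := LinearMap.mul' k (A ⊗[k] A) ∘ₗ
    TensorProduct.map (TensorProduct.map (antipode k) (antipode k) ∘ₗ
      (TensorProduct.comm k A A).toLinearMap) comul ∘ₗ
    (TensorProduct.comm k A (A ⊗[k] A)).toLinearMap
  let H : A ⊗[k] (A ⊗[k] A) →ₗ[k] A ⊗[k] A := LinearMap.mul' k (A ⊗[k] A) ∘ₗ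
    TensorProduct.map
      ((Algebra.TensorProduct.includeRight : A →ₐ[k] A ⊗[k] A).toLinearMap ∘ₗ antipode k)
      (LinearMap.mulLeft k W ∘ₗ (antipode k ∘ₗ antipode k).rTensor A) ∘ₗ
    (TensorProduct.comm k (A ⊗[k] A) A).toLinearMap ∘ₗ
    (TensorProduct.assoc k A A A).symm.toLinearMap
  have hG : ∀ x : A ⊗[k] A, comul (R := k) (antipodeContract k A x) = G (comul.lTensor A x) := by
    intro x
    induction x with
    | zero => simp
    | add x y hx hy => simp only [map_add, hx, hy]
    | tmul a b => simp [G, comul_antipode]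
  have hGX : ∀ x y : A ⊗[k] A, G (leg13 x * leg12 y) = LinearMap.mul' k (A ⊗[k] A)
      (TensorProduct.map
        ((Algebra.TensorProduct.includeRight : A →ₐ[k] A ⊗[k] A).toLinearMap ∘ₗ antipode k)
        (LinearMap.mulLeft k (X x) ∘ₗ comul) (swap y)) := by
    intro x y
    induction y with
    | zero => simp [leg12, swap]
    | add y y' hy hy' =>
      simp only [leg12, swap, map_add, TensorProduct.add_tmul, mul_add] at *
      rw [hy, hy']
    | tmul c d =>
      induction x with
      | zero => simp [leg13, X, swap]
      | add x x' hx hx' =>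
        simp only [X, leg13, swap, map_add, add_mul, TensorProduct.comm_tmul,
          TensorProduct.map_tmul, LinearMap.mul'_apply, LinearMap.comp_apply,
          LinearMap.mulLeft_apply, mul_add] at *
        rw [hx, hx']
      | tmul a b => simp [G, X, leg13, leg12, swap, ← mul_assoc]
  -- Moving `u ⊗ 1` past `Δ(c)` replaces `c₁` by `S²(c₁)`, by `u x = S²(x) u`.
  have hXH : ∀ y : A ⊗[k] A, LinearMap.mul' k (A ⊗[k] A)
      (TensorProduct.map
        ((Algebra.TensorProduct.includeRight : A →ₐ[k] A ⊗[k] A).toLinearMap ∘ₗ antipode k)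
        (LinearMap.mulLeft k (W * drinfeldElement R ⊗ₜ[k] (1 : A)) ∘ₗ comul) (swap y)) =
      H (TensorProduct.assoc k A A A (comul.rTensor A y)) * drinfeldElement R ⊗ₜ[k] (1 : A) := by
    intro y
    induction y with
    | zero => simp [swap]
    | add y y' hy hy' =>
      simp only [swap, map_add, add_mul] at *
      rw [hy, hy']
    | tmul c d =>
      simp only [swap, TensorProduct.comm_tmul, TensorProduct.map_tmul, LinearMap.rTensor_tmul,
        LinearMap.mul'_apply, LinearMap.comp_apply, LinearMap.mulLeft_apply]
      induction comul (R := k) c with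
      | zero => simp
      | add y z hy hz => simp only [map_add, mul_add, add_mul, TensorProduct.add_tmul, hy, hz]
      | tmul e f => simp [H, mul_assoc, hR.drinfeldElement_mul]
  -- Gathers `W` with one copy of `R`, so that `(S ⊗ S)(R) = R` reduces `Z R` to `(S ⊗ I)(R R₂₁) =
  -- 1`.
  let Z : A ⊗[k] A → A ⊗[k] A := fun x ↦
    TensorProduct.map (antipode k) LinearMap.id (TensorProduct.map (antipode k) (antipode k) x * swap R)
  have hHZ : ∀ x y : A ⊗[k] A, H (leg13 x * leg23 y) = LinearMap.mul' k (A ⊗[k] A)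
      (TensorProduct.map
        ((Algebra.TensorProduct.includeRight : A →ₐ[k] A ⊗[k] A).toLinearMap ∘ₗ antipode k)
        (LinearMap.mulLeft k (Z x) ∘ₗ
          (Algebra.TensorProduct.includeRight : A →ₐ[k] A ⊗[k] A).toLinearMap) (swap y)) := by
    intro x y
    induction y with
    | zero => simp [leg23, swap]
    | add y y' hy hy' =>
      simp only [leg23, swap, map_add, TensorProduct.tmul_add, mul_add] at *
      rw [hy, hy']
    | tmul g h =>
      induction x with
      | zero => simp [leg13, Z]
      | add x x' hx hx' =>
        simp only [Z, leg13, swap, map_add, add_mul, TensorProduct.comm_tmul,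
          TensorProduct.map_tmul, LinearMap.mul'_apply, LinearMap.comp_apply,
          LinearMap.mulLeft_apply, mul_add] at *
        rw [hx, hx']
      | tmul e f =>
        simp only [H, Z, W, leg13, leg23]
        induction swap R with
        | zero => simp
        | add y z hy hz =>
          simp only [swap, map_add, mul_add, TensorProduct.comm_tmul, LinearMap.lTensor_tmul,
            TensorProduct.mk_apply, Algebra.TensorProduct.tmul_mul_tmul, LinearMap.comp_apply,
            LinearEquiv.coe_coe, TensorProduct.assoc_symm_tmul, add_mul,
            TensorProduct.map_tmul, LinearMap.mul'_apply, LinearMap.mulLeft_apply] at *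
          rw [hy, hz]
        | tmul b a => simp [swap, antipode_mul_antidistrib, mul_assoc]
  have hZ : Z R = 1 := by
    simp only [Z]
    rw [hR.map_antipode_antipode, hR.mul_swap, Algebra.TensorProduct.one_def]
    simp
  have hlast : ∀ y : A ⊗[k] A, LinearMap.mul' k (A ⊗[k] A)
      (TensorProduct.map
        ((Algebra.TensorProduct.includeRight : A →ₐ[k] A ⊗[k] A).toLinearMap ∘ₗ antipode k)
        (LinearMap.mulLeft k (1 : A ⊗[k] A) ∘ₗ
          (Algebra.TensorProduct.includeRight : A →ₐ[k] A ⊗[k] A).toLinearMap) (swap y)) =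
      (1 : A) ⊗ₜ[k] antipodeContract k A y := by
    intro y
    induction y with
    | zero => simp [swap]
    | add y y' hy hy' =>
      simp only [swap, map_add, TensorProduct.tmul_add] at *
      rw [hy, hy']
    | tmul g h => simp [swap]
  have hX : X R = W * drinfeldElement R ⊗ₜ[k] (1 : A) := hR.antipode_tmul_one_mul_comul_legs
  conv_lhs => rw [drinfeldElement_eq]
  rw [hG, hR.comul_right, hGX, hX, hXH, hR.comul_left, hHZ, hZ, hlast, ← drinfeldElement_eq]
  simp

theorem IsTriangular.isGroupLikeElem_drinfeldElement (hR : IsTriangular R) :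
    IsGroupLikeElem k (drinfeldElement R) where
  counit_eq_one := hR.counit_drinfeldElement
  comul_eq_tmul_self := hR.comul_drinfeldElement

end Drinfeld

end TriHopf
end

noncomputable section

namespace TriHopf

/-! ### Images of triangular structures under Hopf algebra maps. -/

section Pushforward

variable {k A K : Type*} [Field k] [Ring A] [HopfAlgebra k A] [Ring K] [HopfAlgebra k K]
  {R : A ⊗[k] A}

/-- The image of `R` in `K ⊗ K` under a Hopf algebra map `A → K`. -/
def pushforward (π : A →ₐc[k] K) : A ⊗[k] A →ₐ[k] K ⊗[k] K :=
  Algebra.TensorProduct.map (π : A →ₐ[k] K) (π : A →ₐ[k] K)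

/-- The map `π ⊗ π ⊗ π`. -/
def pushforward₃ (π : A →ₐc[k] K) : A ⊗[k] (A ⊗[k] A) →ₐ[k] K ⊗[k] (K ⊗[k] K) :=
  Algebra.TensorProduct.map (π : A →ₐ[k] K) (pushforward π)

@[simp]
theorem pushforward_tmul (π : A →ₐc[k] K) (a b : A) :
    pushforward π (a ⊗ₜ[k] b) = π a ⊗ₜ[k] π b := rfl

@[simp]
theorem pushforward₃_tmul (π : A →ₐc[k] K) (a : A) (x : A ⊗[k] A) :
    pushforward₃ π (a ⊗ₜ[k] x) = π a ⊗ₜ[k] pushforward π x := rfl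

theorem pushforward_eq_map (π : A →ₐc[k] K) (x : A ⊗[k] A) :
    pushforward π x = TensorProduct.map (π : A →ₗ[k] K) (π : A →ₗ[k] K) x := rfl

theorem pushforward_comul (π : A →ₐc[k] K) (a : A) :
    pushforward π (Coalgebra.comul (R := k) a) = Coalgebra.comul (R := k) (π a) :=
  CoalgHomClass.map_comp_comul_apply π a

theorem pushforward_swap (π : A →ₐc[k] K) (x : A ⊗[k] A) :
    pushforward π (swap x) = swap (pushforward π x) := by
  induction x with
  | zero => simp [swap]
  | add x y hx hy => simp only [swap, map_add] at *; rw [hx, hy]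
  | tmul a b => simp [swap]

theorem pushforward₃_leg12 (π : A →ₐc[k] K) (x : A ⊗[k] A) :
    pushforward₃ π (leg12 x) = leg12 (pushforward π x) := by
  induction x with
  | zero => simp [leg12]
  | add x y hx hy => simp only [leg12, map_add, TensorProduct.add_tmul] at *; rw [hx, hy]
  | tmul a b => simp [leg12]

theorem pushforward₃_leg13 (π : A →ₐc[k] K) (x : A ⊗[k] A) :
    pushforward₃ π (leg13 x) = leg13 (pushforward π x) := by
  induction x with
  | zero => simp [leg13]
  | add x y hx hy => simp only [leg13, map_add] at *; rw [hx, hy]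
  | tmul a b => simp [leg13]

theorem pushforward₃_leg23 (π : A →ₐc[k] K) (x : A ⊗[k] A) :
    pushforward₃ π (leg23 x) = leg23 (pushforward π x) := by
  simp [leg23]

theorem pushforward₃_comul_right (π : A →ₐc[k] K) (x : A ⊗[k] A) :
    pushforward₃ π (Coalgebra.comul.lTensor A x) =
      Coalgebra.comul.lTensor K (pushforward π x) := by
  induction x with
  | zero => simp
  | add x y hx hy => simp only [map_add, hx, hy]
  | tmul a b => simp [pushforward_comul]

theorem pushforward₃_comul_left (π : A →ₐc[k] K) (x : A ⊗[k] A) :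
    pushforward₃ π (TensorProduct.assoc k A A A (Coalgebra.comul.rTensor A x)) =
      TensorProduct.assoc k K K K (Coalgebra.comul.rTensor K (pushforward π x)) := by
  induction x with
  | zero => simp
  | add x y hx hy => simp only [map_add, hx, hy]
  | tmul a b =>
    rw [pushforward_tmul, LinearMap.rTensor_tmul, LinearMap.rTensor_tmul, ← pushforward_comul]
    induction Coalgebra.comul (R := k) a with
    | zero => simp
    | add x y hx hy => simp only [map_add, TensorProduct.add_tmul, hx, hy]
    | tmul c d => simp

theorem IsTriangular.pushforward (hR : IsTriangular R) (π : A →ₐc[k] K)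
    (hπ : Function.Surjective π) : IsTriangular (pushforward π R) where
  isUnit := hR.isUnit.map (TriHopf.pushforward π)
  swap_comul_mul := by
    intro x
    obtain ⟨a, rfl⟩ := hπ x
    rw [← pushforward_comul, ← pushforward_swap, ← map_mul, hR.swap_comul_mul, map_mul]
  comul_left := by
    rw [← pushforward₃_comul_left, hR.comul_left, map_mul, pushforward₃_leg13, pushforward₃_leg23]
  comul_right := by
    rw [← pushforward₃_comul_right, hR.comul_right, map_mul, pushforward₃_leg13,
      pushforward₃_leg12]
  mul_swap := by rw [← pushforward_swap, ← map_mul, hR.mul_swap, map_one]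
  swap_mul := by rw [← pushforward_swap, ← map_mul, hR.swap_mul, map_one]

theorem drinfeldElement_pushforward (π : A →ₐc[k] K) (x : A ⊗[k] A) :
    drinfeldElement (pushforward π x) = π (drinfeldElement x) := by
  rw [drinfeldElement_eq, drinfeldElement_eq]
  induction x with
  | zero => simp
  | add x y hx hy => simp only [map_add, hx, hy]
  | tmul a b => simp [map_antipode_bialgHom]

end Pushforward

/-! ### Minimality of the image of `R` on the group algebra. -/

section Minimal

variable {k A : Type*} [Field k] [CharZero k] [Ring A] [HopfAlgebra k A] {R : A ⊗[k] A}

/-- The slice of `(π ⊗ π)(R)` by `p` is `π` of the slice of `R` by `p ∘ π`, and `χ_g` reads off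
`p(π(g)) = p(g)` from it. So the slice determines `p`, and equality of dimensions turns injectivity
into surjectivity. -/
theorem IsMinimalTriangular.rightSlice_pushforward_surjective (hA : IsPointed k A)
    (hR : IsMinimalTriangular R) :
    Function.Surjective (rightSlice (pushforward (hR.proj hA) R)) := by
  have := hR.finiteDimensional
  have hfin := finite_groupLike (k := k) (A := A)
  have e : GroupLikeAlgebra k A ≃ₗ[k] (GroupLike k A →₀ k) := MonoidAlgebra.coeffLinearEquiv k
  have : Module.Finite k (GroupLikeAlgebra k A) := Module.Finite.equiv e.symm
  refine (LinearMap.injective_iff_surjective_of_finrank_eq_finrank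
    Subspace.dual_finrank_eq).1 ?_
  rw [injective_iff_map_eq_zero]
  intro p hp
  rw [pushforward_eq_map, rightSlice_map] at hp
  have h : ∀ g : GroupLike k A, p (MonoidAlgebra.single g 1) = 0 := by
    intro g
    have h₁ := hR.character_groupLikeIncl_proj hA g
      (rightSlice R (p ∘ₗ (hR.proj hA : A →ₗ[k] GroupLikeAlgebra k A)))
    have h₂ : hR.proj hA (rightSlice R (p ∘ₗ (hR.proj hA : A →ₗ[k] GroupLikeAlgebra k A))) = 0 :=
      hp
    rw [h₂, map_zero, map_zero, hR.character_rightSlice] at h₁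
    have h₃ := hR.proj_groupLikeIncl hA (MonoidAlgebra.single g 1)
    rw [groupLikeIncl_single, one_smul] at h₃
    rw [← h₃]
    exact h₁.symm
  ext g
  simpa using h g

theorem IsMinimalTriangular.pushforward_proj (hA : IsPointed k A) (hR : IsMinimalTriangular R) :
    IsMinimalTriangular (pushforward (hR.proj hA) R) where
  toIsTriangular := hR.toIsTriangular.pushforward _ fun x ↦ ⟨_, hR.proj_groupLikeIncl hA x⟩
  eq_top := by
    intro C _ hC
    rw [eq_top_iff]
    rintro x -
    obtain ⟨p, rfl⟩ := hR.rightSlice_pushforward_surjective hA x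
    exact rightSlice_mem hC p

/-- The Drinfeld element is carried along by `π`, and `i ∘ π` fixes it because it is grouplike. -/
theorem IsMinimalTriangular.groupLikeIncl_drinfeldElement_pushforward (hA : IsPointed k A)
    (hR : IsMinimalTriangular R) :
    groupLikeIncl k A (drinfeldElement (pushforward (hR.proj hA) R)) = drinfeldElement R := by
  have h : drinfeldElement R = groupLikeIncl k A
      (MonoidAlgebra.single ⟨_, hR.toIsTriangular.isGroupLikeElem_drinfeldElement⟩ 1) := by
    rw [groupLikeIncl_single, one_smul]
  rw [drinfeldElement_pushforward, h, hR.proj_groupLikeIncl]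

end Minimal

end TriHopf
end

noncomputable section

namespace TriHopf

/-! ### The right coaction induced by a Hopf algebra map to a group algebra. -/

section Coinvariants

open HopfAlgebra Coalgebra

variable {k G A : Type*} [Field k] [Group G] [Ring A] [HopfAlgebra k A]
  (π : A →ₐc[k] MonoidAlgebra k G)

/-- The right coaction `(I ⊗ π) Δ`. -/
def rightCoaction : A →ₐ[k] A ⊗[k] MonoidAlgebra k G :=
  (Algebra.TensorProduct.map (AlgHom.id k A) (π : A →ₐ[k] MonoidAlgebra k G)).comp
    (Bialgebra.comulAlgHom k A)

theorem rightCoaction_eq (a : A) : rightCoaction π a =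
    (π : A →ₗ[k] MonoidAlgebra k G).lTensor A (comul a) := rfl

theorem mem_rightCoinvariants {a : A} :
    a ∈ rightCoinvariants π ↔ rightCoaction π a = a ⊗ₜ[k] 1 := Iff.rfl

theorem rightCoaction_rightCoaction (a : A) :
    TensorProduct.assoc k A (MonoidAlgebra k G) (MonoidAlgebra k G)
      ((rightCoaction π).toLinearMap.rTensor (MonoidAlgebra k G) (rightCoaction π a)) =
        comul.lTensor A (rightCoaction π a) := by
  have h₁ : ∀ y : A ⊗[k] A, TensorProduct.assoc k A (MonoidAlgebra k G) (MonoidAlgebra k G)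
      ((rightCoaction π).toLinearMap.rTensor (MonoidAlgebra k G)
        ((π : A →ₗ[k] MonoidAlgebra k G).lTensor A y)) =
      (pushforward π).toLinearMap.lTensor A (TensorProduct.assoc k A A A (comul.rTensor A y)) := by
    intro y
    induction y with
    | zero => simp
    | add y z hy hz => simp only [map_add, hy, hz]
    | tmul a b =>
      simp only [LinearMap.lTensor_tmul, LinearMap.rTensor_tmul, AlgHom.toLinearMap_apply,
        rightCoaction_eq]
      induction comul (R := k) a with
      | zero => simp
      | add y z hy hz => simp only [map_add, TensorProduct.add_tmul, hy, hz]
      | tmul c d => simp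
  have h₂ : ∀ y : A ⊗[k] A, (pushforward π).toLinearMap.lTensor A (comul.lTensor A y) =
      comul.lTensor A ((π : A →ₗ[k] MonoidAlgebra k G).lTensor A y) := by
    intro y
    induction y with
    | zero => simp
    | add y z hy hz => simp only [map_add, hy, hz]
    | tmul a b =>
      simp only [LinearMap.lTensor_tmul, AlgHom.toLinearMap_apply, pushforward_comul]
      rfl
  rw [rightCoaction_eq, h₁, coassoc_apply, h₂]

/-- Both sides are `a₁ ⊗ a₂ ⊗ π(a₃)`. For coinvariant `a` it shows that the second leg of `Δ(a)` is
again coinvariant. -/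
theorem lTensor_rightCoaction_comul (a : A) :
    (rightCoaction π).toLinearMap.lTensor A (comul (R := k) a) =
      TensorProduct.assoc k A A (MonoidAlgebra k G)
        (comul.rTensor (MonoidAlgebra k G) (rightCoaction π a)) := by
  have h₁ : ∀ y : A ⊗[k] A, (rightCoaction π).toLinearMap.lTensor A y =
      ((π : A →ₗ[k] MonoidAlgebra k G).lTensor A).lTensor A (comul.lTensor A y) := by
    intro y
    induction y with
    | zero => simp
    | add y z hy hz => simp only [map_add, hy, hz]
    | tmul a b => simp [rightCoaction_eq]
  have h₂ : ∀ y : A ⊗[k] A, TensorProduct.assoc k A A (MonoidAlgebra k G)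
      (comul.rTensor (MonoidAlgebra k G) ((π : A →ₗ[k] MonoidAlgebra k G).lTensor A y)) =
      ((π : A →ₗ[k] MonoidAlgebra k G).lTensor A).lTensor A
        (TensorProduct.assoc k A A A (comul.rTensor A y)) := by
    intro y
    induction y with
    | zero => simp
    | add y z hy hz => simp only [map_add, hy, hz]
    | tmul a b =>
      simp only [LinearMap.lTensor_tmul, LinearMap.rTensor_tmul]
      induction comul (R := k) a with
      | zero => simp
      | add y z hy hz => simp only [map_add, TensorProduct.add_tmul, hy, hz]
      | tmul c d => simp
  rw [h₁, rightCoaction_eq, h₂, coassoc_apply]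

theorem lTensor_counit_rightCoaction (a : A) :
    (counit (R := k)).lTensor A (rightCoaction π a) = a ⊗ₜ[k] (1 : k) := by
  have h : ∀ y : A ⊗[k] A, (counit (R := k)).lTensor A
      ((π : A →ₗ[k] MonoidAlgebra k G).lTensor A y) = (counit (R := k)).lTensor A y := by
    intro y
    induction y with
    | zero => simp
    | add y z hy hz => simp only [map_add, hy, hz]
    | tmul a b =>
      simp only [LinearMap.lTensor_tmul]
      congr 1
      exact CoalgHomClass.counit_comp_apply π b
  rw [rightCoaction_eq, h, lTensor_counit_comul]

theorem proj_of_mem_rightCoinvariants {b : A} (hb : b ∈ rightCoinvariants π) :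
    π b = counit (R := k) b • 1 := by
  have h : ∀ y : A ⊗[k] A, TensorProduct.lid k (MonoidAlgebra k G)
      ((counit (R := k)).rTensor (MonoidAlgebra k G)
        ((π : A →ₗ[k] MonoidAlgebra k G).lTensor A y)) =
      π (TensorProduct.lid k A ((counit (R := k)).rTensor A y)) := by
    intro y
    induction y with
    | zero => simp
    | add y z hy hz => simp only [map_add, hy, hz]
    | tmul a b => simp
  have h' := h (comul b)
  rw [← rightCoaction_eq, (mem_rightCoinvariants π).1 hb, rTensor_counit_comul] at h'
  simpa using h'.symm

end Coinvariants
end TriHopf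
end

noncomputable section

namespace TriHopf

/-! ### The projection onto the coinvariants and the isomorphism `B ⊗ K ≃ A`. -/

section CoinvariantProjection

open HopfAlgebra Coalgebra

variable {k G A : Type*} [Field k] [Group G] [Ring A] [HopfAlgebra k A]
  (π : A →ₐc[k] MonoidAlgebra k G) (ι : MonoidAlgebra k G →ₐc[k] A)

/-- The map `a ⊗ h ↦ a ι(S(h))`. -/
def mulAntipode : A ⊗[k] MonoidAlgebra k G →ₗ[k] A :=
  LinearMap.mul' k A ∘ₗ ((ι : MonoidAlgebra k G →ₗ[k] A) ∘ₗ antipode k).lTensor A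

@[simp]
theorem mulAntipode_tmul (a : A) (h : MonoidAlgebra k G) :
    mulAntipode ι (a ⊗ₜ[k] h) = a * ι (antipode k h) := by
  simp [mulAntipode]

theorem comul_single_one {X : Type*} (g : X) : comul (R := k) (MonoidAlgebra.single g (1 : k)) =
    MonoidAlgebra.single g (1 : k) ⊗ₜ[k] MonoidAlgebra.single g (1 : k) := by
  simp

theorem antipode_single_one (g : G) : antipode k (MonoidAlgebra.single g (1 : k)) =
    MonoidAlgebra.single g⁻¹ (1 : k) := by
  simp

theorem single_mul_single_inv (g : G) :
    MonoidAlgebra.single g (1 : k) * MonoidAlgebra.single g⁻¹ (1 : k) = 1 := by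
  simp [MonoidAlgebra.single_mul_single, MonoidAlgebra.one_def]

theorem single_inv_mul_single (g : G) :
    MonoidAlgebra.single g⁻¹ (1 : k) * MonoidAlgebra.single g (1 : k) = 1 := by
  simp [MonoidAlgebra.single_mul_single, MonoidAlgebra.one_def]

/-- Induction on tensors, with no case for zero. -/
theorem tensor_add_induction {M N : Type*} [AddCommGroup M] [Module k M] [AddCommGroup N]
    [Module k N] {P : M ⊗[k] N → Prop} (add : ∀ x y, P x → P y → P (x + y))
    (tmul : ∀ m n, P (m ⊗ₜ[k] n)) (x : M ⊗[k] N) : P x := by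
  induction x with
  | zero => simpa using tmul 0 0
  | add x y hx hy => exact add x y hx hy
  | tmul m n => exact tmul m n

/-- Induction on tensors with a group algebra: it suffices to treat the tensors `m ⊗ g`. -/
theorem tensor_single_induction {M : Type*} [AddCommGroup M] [Module k M]
    {P : M ⊗[k] MonoidAlgebra k G → Prop} (add : ∀ x y, P x → P y → P (x + y))
    (tmul : ∀ m g, P (m ⊗ₜ[k] MonoidAlgebra.single g (1 : k))) (x : M ⊗[k] MonoidAlgebra k G) :
    P x := by
  have h0 : P 0 := by simpa using tmul 0 1
  induction x with
  | zero => exact h0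
  | add x y hx hy => exact add x y hx hy
  | tmul m h =>
    induction h using MonoidAlgebra.induction_linear with
    | zero => simpa using h0
    | add x y hx hy =>
      rw [TensorProduct.tmul_add]
      exact add _ _ hx hy
    | single g c =>
      have : m ⊗ₜ[k] MonoidAlgebra.single g c = (c • m) ⊗ₜ[k] MonoidAlgebra.single g (1 : k) := by
        rw [TensorProduct.smul_tmul]
        simp
      rw [this]
      exact tmul _ _

theorem comul_incl_single (g : G) : comul (R := k) (ι (MonoidAlgebra.single g 1)) =
    ι (MonoidAlgebra.single g 1) ⊗ₜ[k] ι (MonoidAlgebra.single g 1) := by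
  rw [← CoalgHomClass.map_comp_comul_apply ι, comul_single_one]
  rfl

theorem counit_incl_single (g : G) : counit (R := k) (ι (MonoidAlgebra.single g 1)) = 1 := by
  rw [CoalgHomClass.counit_comp_apply]
  simp

variable {π ι}

theorem rightCoaction_incl_single (hπ : ∀ x, π (ι x) = x) (g : G) :
    rightCoaction π (ι (MonoidAlgebra.single g 1)) =
      ι (MonoidAlgebra.single g 1) ⊗ₜ[k] MonoidAlgebra.single g 1 := by
  rw [rightCoaction_eq, comul_incl_single, LinearMap.lTensor_tmul]
  congr 1
  exact hπ _

theorem rightCoaction_mul_single (hπ : ∀ x, π (ι x) = x) {b : A} (hb : b ∈ rightCoinvariants π)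
    (g : G) : rightCoaction π (b * ι (MonoidAlgebra.single g 1)) =
      (b * ι (MonoidAlgebra.single g 1)) ⊗ₜ[k] MonoidAlgebra.single g 1 := by
  rw [map_mul, rightCoaction_incl_single hπ, (mem_rightCoinvariants π).1 hb]
  simp

/-- In terms of the `G`-grading, a component of degree `g` is multiplied by `ι(g⁻¹)` and so lands in
degree `1`. Coassociativity of the coaction replaces an explicit decomposition into components. -/
theorem mulAntipode_rightCoaction_mem (hπ : ∀ x, π (ι x) = x) (a : A) :
    mulAntipode ι (rightCoaction π a) ∈ rightCoinvariants π := by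
  rw [mem_rightCoinvariants]
  have h₁ : ∀ z : A ⊗[k] MonoidAlgebra k G, rightCoaction π (mulAntipode ι z) =
      LinearMap.mul' k _ (TensorProduct.map LinearMap.id ((rightCoaction π).toLinearMap ∘ₗ
        (ι : MonoidAlgebra k G →ₗ[k] A) ∘ₗ antipode k)
        ((rightCoaction π).toLinearMap.rTensor (MonoidAlgebra k G) z)) := by
    intro z
    induction z with
    | zero => simp
    | add y z hy hz => simp only [map_add, hy, hz]
    | tmul a h => simp
  have h₂ : ∀ z : A ⊗[k] MonoidAlgebra k G,
      LinearMap.mul' k _ (TensorProduct.map LinearMap.id ((rightCoaction π).toLinearMap ∘ₗ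
        (ι : MonoidAlgebra k G →ₗ[k] A) ∘ₗ antipode k)
        ((TensorProduct.assoc k A (MonoidAlgebra k G) (MonoidAlgebra k G)).symm
          (comul.lTensor A z))) = mulAntipode ι z ⊗ₜ[k] 1 := by
    intro z
    induction z using tensor_single_induction with
    | add x y hx hy => simp only [map_add, hx, hy, TensorProduct.add_tmul]
    | tmul a g =>
      rw [LinearMap.lTensor_tmul, comul_single_one, TensorProduct.assoc_symm_tmul,
        TensorProduct.map_tmul, LinearMap.comp_apply, LinearMap.comp_apply, antipode_single_one,
        mulAntipode_tmul, antipode_single_one]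
      change a ⊗ₜ[k] MonoidAlgebra.single g 1 * rightCoaction π (ι (MonoidAlgebra.single g⁻¹ 1)) = _
      rw [rightCoaction_incl_single hπ, Algebra.TensorProduct.tmul_mul_tmul, single_mul_single_inv]
  rw [h₁, ← h₂, ← rightCoaction_rightCoaction, LinearEquiv.symm_apply_apply]

/-- The projection `a ↦ a₁ ι(S(π(a₂)))` of `A` onto the coinvariants. -/
def coinvProj (hπ : ∀ x, π (ι x) = x) : A →ₗ[k] rightCoinvariants π :=
  (mulAntipode ι ∘ₗ (rightCoaction π).toLinearMap).codRestrict
    (Subalgebra.toSubmodule (rightCoinvariants π)) (mulAntipode_rightCoaction_mem hπ)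

theorem coe_coinvProj (hπ : ∀ x, π (ι x) = x) (a : A) :
    (coinvProj hπ a : A) = mulAntipode ι (rightCoaction π a) := rfl

/-- Right multiplication by `ι(g)` shifts degrees by `g`, and the compensating inverse factor undoes
it. -/
theorem coinvProj_mul_single (hπ : ∀ x, π (ι x) = x) (a : A) (g : G) :
    coinvProj hπ (a * ι (MonoidAlgebra.single g 1)) = coinvProj hπ a := by
  have h : ∀ z : A ⊗[k] MonoidAlgebra k G, mulAntipode ι
      (z * ι (MonoidAlgebra.single g 1) ⊗ₜ[k] MonoidAlgebra.single g 1) = mulAntipode ι z := by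
    intro z
    induction z with
    | zero => simp
    | add y z hy hz => simp only [map_add, add_mul, hy, hz]
    | tmul a h =>
      rw [Algebra.TensorProduct.tmul_mul_tmul, mulAntipode_tmul, antipode_mul_antidistrib,
        antipode_single_one, map_mul, mul_assoc, ← mul_assoc (ι _) (ι _), ← map_mul,
        single_mul_single_inv, map_one, one_mul, mulAntipode_tmul]
  refine Subtype.ext ?_
  rw [coe_coinvProj, map_mul, rightCoaction_incl_single hπ, h, coe_coinvProj]

@[simp]
theorem coinvProj_coe (hπ : ∀ x, π (ι x) = x) (b : rightCoinvariants π) :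
    coinvProj hπ (b : A) = b := by
  refine Subtype.ext ?_
  rw [coe_coinvProj, (mem_rightCoinvariants π).1 b.2]
  simp

theorem coinvProj_coe_mul_single (hπ : ∀ x, π (ι x) = x) (b : rightCoinvariants π) (g : G) :
    coinvProj hπ (b * ι (MonoidAlgebra.single g 1)) = b := by
  rw [coinvProj_mul_single, coinvProj_coe]

variable (π ι) in
/-- The multiplication map `b ⊗ h ↦ b ι(h)`. -/
def biproductMul : rightCoinvariants π ⊗[k] MonoidAlgebra k G →ₗ[k] A :=
  LinearMap.mul' k A ∘ₗ TensorProduct.map (rightCoinvariants π).val.toLinearMap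
    (ι : MonoidAlgebra k G →ₗ[k] A)

@[simp]
theorem biproductMul_tmul (b : rightCoinvariants π) (h : MonoidAlgebra k G) :
    biproductMul π ι (b ⊗ₜ[k] h) = b * ι h := by
  simp [biproductMul]

theorem biproductMul_coinvProj_rightCoaction (hπ : ∀ x, π (ι x) = x) (a : A) :
    biproductMul π ι ((coinvProj hπ).rTensor (MonoidAlgebra k G) (rightCoaction π a)) = a := by
  have h₁ : ∀ z : A ⊗[k] MonoidAlgebra k G,
      biproductMul π ι ((coinvProj hπ).rTensor (MonoidAlgebra k G) z) =
      LinearMap.mul' k A (TensorProduct.map (mulAntipode ι) (ι : MonoidAlgebra k G →ₗ[k] A)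
        ((rightCoaction π).toLinearMap.rTensor (MonoidAlgebra k G) z)) := by
    intro z
    induction z with
    | zero => simp
    | add y z hy hz => simp only [map_add, hy, hz]
    | tmul a h => simp [coe_coinvProj]
  have h₂ : ∀ z : A ⊗[k] MonoidAlgebra k G,
      LinearMap.mul' k A (TensorProduct.map (mulAntipode ι) (ι : MonoidAlgebra k G →ₗ[k] A)
        ((TensorProduct.assoc k A (MonoidAlgebra k G) (MonoidAlgebra k G)).symm
          (comul.lTensor A z))) = TensorProduct.rid k A ((counit (R := k)).lTensor A z) := by
    intro z
    induction z using tensor_single_induction with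
    | add x y hx hy => simp only [map_add, hx, hy]
    | tmul a g =>
      rw [LinearMap.lTensor_tmul, comul_single_one, TensorProduct.assoc_symm_tmul,
        TensorProduct.map_tmul, mulAntipode_tmul, antipode_single_one, LinearMap.mul'_apply]
      change a * ι _ * ι _ = _
      rw [mul_assoc, ← map_mul, single_inv_mul_single]
      simp
  rw [h₁]
  have h := rightCoaction_rightCoaction π a
  rw [← LinearEquiv.eq_symm_apply] at h
  rw [h, h₂, lTensor_counit_rightCoaction]
  simp

/-- Radford's isomorphism `B ⊗ K ≃ A`, `b ⊗ h ↦ b ι(h)`. -/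
def biproductEquiv (hπ : ∀ x, π (ι x) = x) :
    rightCoinvariants π ⊗[k] MonoidAlgebra k G ≃ₗ[k] A :=
  LinearEquiv.ofLinearMap (biproductMul π ι)
    ((coinvProj hπ).rTensor (MonoidAlgebra k G) ∘ₗ (rightCoaction π).toLinearMap)
    (LinearMap.ext (biproductMul_coinvProj_rightCoaction hπ))
    (LinearMap.ext fun z ↦ by
      induction z using tensor_single_induction with
      | add x y hx hy => simp only [map_add, hx, hy]
      | tmul b g =>
        rw [LinearMap.comp_apply, biproductMul_tmul, LinearMap.comp_apply,
          AlgHom.toLinearMap_apply, rightCoaction_mul_single hπ b.2, LinearMap.rTensor_tmul,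
          coinvProj_coe_mul_single]
        rfl)

theorem biproductEquiv_apply (hπ : ∀ x, π (ι x) = x)
    (z : rightCoinvariants π ⊗[k] MonoidAlgebra k G) :
    biproductEquiv hπ z = biproductMul π ι z := rfl

/-- `A` is spanned by the products of coinvariants and group elements. -/
theorem coinvariants_induction (hπ : ∀ x, π (ι x) = x) {P : A → Prop}
    (add : ∀ x y, P x → P y → P (x + y))
    (mul : ∀ (b : rightCoinvariants π) g, P (b * ι (MonoidAlgebra.single g 1))) (a : A) : P a := by
  rw [← (biproductEquiv hπ).apply_symm_apply a]
  induction (biproductEquiv hπ).symm a using tensor_single_induction with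
  | add x y hx hy =>
    rw [map_add]
    exact add _ _ hx hy
  | tmul b g =>
    rw [biproductEquiv_apply, biproductMul_tmul]
    exact mul b g

/-- `Δ(b)` lies in `A ⊗ B`, since `(I ⊗ ρ) Δ(b) = Δ(b) ⊗ 1` for the right coaction `ρ`. Hence
projecting its second leg changes nothing. -/
theorem lTensor_coinvProj_comul (hπ : ∀ x, π (ι x) = x) (b : rightCoinvariants π) :
    ((rightCoinvariants π).val.toLinearMap ∘ₗ coinvProj hπ).lTensor A (comul (R := k) (b : A)) =
      comul (R := k) (b : A) := by
  have h : (rightCoinvariants π).val.toLinearMap ∘ₗ coinvProj hπ =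
      mulAntipode ι ∘ₗ (rightCoaction π).toLinearMap := rfl
  rw [h, LinearMap.lTensor_comp, LinearMap.comp_apply, lTensor_rightCoaction_comul,
    (mem_rightCoinvariants π).1 b.2, LinearMap.rTensor_tmul]
  induction comul (R := k) (b : A) with
  | zero => simp
  | add x y hx hy => simp only [map_add, TensorProduct.add_tmul, hx, hy]
  | tmul x y => simp

end CoinvariantProjection
end TriHopf
end

noncomputable section

namespace TriHopf

/-! ### Radford's biproduct structure on the coinvariants. -/

section Biproduct

open HopfAlgebra Coalgebra

variable {k G A : Type*} [Field k] [Group G] [Ring A] [HopfAlgebra k A]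
  {π : A →ₐc[k] MonoidAlgebra k G} {ι : MonoidAlgebra k G →ₐc[k] A}

/-- The comultiplication `b ↦ b₁ ι(S(π(b₂))) ⊗ b₃` of the coinvariants. -/
def coinvComul (hπ : ∀ x, π (ι x) = x) :
    rightCoinvariants π →ₗ[k] rightCoinvariants π ⊗[k] rightCoinvariants π :=
  TensorProduct.map (coinvProj hπ) (coinvProj hπ) ∘ₗ comul ∘ₗ
    (rightCoinvariants π).val.toLinearMap

variable (π) in
/-- The counit of the coinvariants. -/
def coinvCounit : rightCoinvariants π →ₗ[k] k :=
  counit ∘ₗ (rightCoinvariants π).val.toLinearMap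

/-- The left coaction `b ↦ π(b₁) ⊗ b₂` on the coinvariants. -/
def coinvCoact (hπ : ∀ x, π (ι x) = x) :
    rightCoinvariants π →ₗ[k] MonoidAlgebra k G ⊗[k] rightCoinvariants π :=
  TensorProduct.map (π : A →ₗ[k] MonoidAlgebra k G) (coinvProj hπ) ∘ₗ comul ∘ₗ
    (rightCoinvariants π).val.toLinearMap

theorem coinvComul_apply (hπ : ∀ x, π (ι x) = x) (b : rightCoinvariants π) :
    coinvComul hπ b = TensorProduct.map (coinvProj hπ) (coinvProj hπ) (comul (R := k) (b : A)) :=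
  rfl

theorem coinvCounit_apply (b : rightCoinvariants π) :
    coinvCounit π b = counit (R := k) (b : A) := rfl

theorem coinvCoact_apply (hπ : ∀ x, π (ι x) = x) (b : rightCoinvariants π) :
    coinvCoact hπ b = TensorProduct.map (π : A →ₗ[k] MonoidAlgebra k G) (coinvProj hπ)
      (comul (R := k) (b : A)) :=
  rfl

/-- On `b ι(g)` the coproduct is `Δ(b) (ι(g) ⊗ ι(g))`, and the projection ignores right factors
`ι(g)`. So the projection respects comultiplication, and the coalgebra axioms descend from `A`. -/
theorem coinvComul_coinvProj (hπ : ∀ x, π (ι x) = x) (a : A) :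
    coinvComul hπ (coinvProj hπ a) =
      TensorProduct.map (coinvProj hπ) (coinvProj hπ) (comul (R := k) a) := by
  have h : ∀ (y : A ⊗[k] A) (g : G), TensorProduct.map (coinvProj hπ) (coinvProj hπ)
      (y * ι (MonoidAlgebra.single g 1) ⊗ₜ[k] ι (MonoidAlgebra.single g 1)) =
      TensorProduct.map (coinvProj hπ) (coinvProj hπ) y := by
    intro y g
    induction y using tensor_add_induction with
    | add y z hy hz => simp only [map_add, add_mul, hy, hz]
    | tmul a b => simp [coinvProj_mul_single]
  induction a using coinvariants_induction hπ with
  | add x y hx hy => simp only [map_add, hx, hy]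
  | mul b g =>
    rw [coinvProj_coe_mul_single, Bialgebra.comul_mul, comul_incl_single, h, coinvComul_apply]

theorem coinvCounit_coinvProj (hπ : ∀ x, π (ι x) = x) (a : A) :
    coinvCounit π (coinvProj hπ a) = counit (R := k) a := by
  induction a using coinvariants_induction hπ with
  | add x y hx hy => simp only [map_add, hx, hy]
  | mul b g =>
    rw [coinvProj_coe_mul_single, Bialgebra.counit_mul, counit_incl_single, mul_one,
      coinvCounit_apply]

/-- Allows the projection to be inserted in, or removed from, the second leg of `Δ(b)` before any
further map is applied. -/
theorem map_coinvProj_comul (hπ : ∀ x, π (ι x) = x) {M N : Type*} [AddCommGroup M] [Module k M]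
    [AddCommGroup N] [Module k N] (f : A →ₗ[k] M) (F : A →ₗ[k] N)
    (b : rightCoinvariants π) :
    TensorProduct.map f (F ∘ₗ (rightCoinvariants π).val.toLinearMap ∘ₗ coinvProj hπ)
      (comul (R := k) (b : A)) = TensorProduct.map f F (comul (R := k) (b : A)) := by
  conv_rhs => rw [← lTensor_coinvProj_comul hπ b]
  rw [LinearMap.lTensor, TensorProduct.map_map, LinearMap.comp_id]

/-- The coalgebra structure on the coinvariants. -/
abbrev coinvCoalgebra (hπ : ∀ x, π (ι x) = x) : Coalgebra k (rightCoinvariants π) where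
  comul := coinvComul hπ
  counit := coinvCounit π
  coassoc := by
    have h₁ : ∀ y : A ⊗[k] A, TensorProduct.assoc k _ _ _ ((coinvComul hπ).rTensor _
        (TensorProduct.map (coinvProj hπ) (coinvProj hπ) y)) =
        TensorProduct.map (coinvProj hπ) (TensorProduct.map (coinvProj hπ) (coinvProj hπ))
          (TensorProduct.assoc k A A A (comul.rTensor A y)) := by
      intro y
      induction y using tensor_add_induction with
      | add y z hy hz => simp only [map_add, hy, hz]
      | tmul a b =>
        simp only [TensorProduct.map_tmul, LinearMap.rTensor_tmul, coinvComul_coinvProj]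
        induction comul (R := k) a using tensor_add_induction with
        | add y z hy hz => simp only [map_add, TensorProduct.add_tmul, hy, hz]
        | tmul c d => simp
    have h₂ : ∀ y : A ⊗[k] A, (coinvComul hπ).lTensor _
        (TensorProduct.map (coinvProj hπ) (coinvProj hπ) y) =
        TensorProduct.map (coinvProj hπ) (TensorProduct.map (coinvProj hπ) (coinvProj hπ))
          (comul.lTensor A y) := by
      intro y
      induction y using tensor_add_induction with
      | add y z hy hz => simp only [map_add, hy, hz]
      | tmul a b => simp [coinvComul_coinvProj]
    ext b
    simp only [LinearMap.comp_apply, LinearEquiv.coe_coe]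
    rw [coinvComul_apply, h₁, h₂, coassoc_apply]
  rTensor_counit_comp_comul := by
    have h : ∀ y : A ⊗[k] A, (coinvCounit π).rTensor _
        (TensorProduct.map (coinvProj hπ) (coinvProj hπ) y) =
        (coinvProj hπ).lTensor k ((counit (R := k)).rTensor A y) := by
      intro y
      induction y using tensor_add_induction with
      | add y z hy hz => simp only [map_add, hy, hz]
      | tmul a b => simp [coinvCounit_coinvProj]
    ext b
    simp only [LinearMap.comp_apply]
    rw [coinvComul_apply, h, rTensor_counit_comul]
    simp
  lTensor_counit_comp_comul := by
    have h : ∀ y : A ⊗[k] A, (coinvCounit π).lTensor _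
        (TensorProduct.map (coinvProj hπ) (coinvProj hπ) y) =
        (coinvProj hπ).rTensor k ((counit (R := k)).lTensor A y) := by
      intro y
      induction y using tensor_add_induction with
      | add y z hy hz => simp only [map_add, hy, hz]
      | tmul a b => simp [coinvCounit_coinvProj]
    ext b
    simp only [LinearMap.comp_apply]
    rw [coinvComul_apply, h, lTensor_counit_comul]
    simp

theorem conj_mem_rightCoinvariants (hπ : ∀ x, π (ι x) = x) (b : rightCoinvariants π) (g : G) :
    ι (MonoidAlgebra.single g 1) * b * ι (MonoidAlgebra.single g⁻¹ 1) ∈ rightCoinvariants π := by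
  rw [mem_rightCoinvariants, map_mul, map_mul, rightCoaction_incl_single hπ,
    rightCoaction_incl_single hπ, (mem_rightCoinvariants π).1 b.2,
    Algebra.TensorProduct.tmul_mul_tmul, Algebra.TensorProduct.tmul_mul_tmul, mul_one,
    single_mul_single_inv]

/-- The action of `G` on the coinvariants by conjugation. -/
def coinvConj (hπ : ∀ x, π (ι x) = x) : G →* Module.End k (rightCoinvariants π) where
  toFun g := (LinearMap.mulRight k (ι (MonoidAlgebra.single g⁻¹ 1)) ∘ₗ
    LinearMap.mulLeft k (ι (MonoidAlgebra.single g 1)) ∘ₗ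
    (rightCoinvariants π).val.toLinearMap).codRestrict
      (Subalgebra.toSubmodule (rightCoinvariants π)) (conj_mem_rightCoinvariants hπ · g)
  map_one' := by
    ext b
    change ι (MonoidAlgebra.single 1 1) * (b : A) * ι (MonoidAlgebra.single 1⁻¹ 1) = b
    rw [inv_one, ← MonoidAlgebra.one_def, map_one, one_mul, mul_one]
  map_mul' g h := by
    ext b
    change ι (MonoidAlgebra.single (g * h) 1) * (b : A) * ι (MonoidAlgebra.single (g * h)⁻¹ 1) =
      ι (MonoidAlgebra.single g 1) * (ι (MonoidAlgebra.single h 1) * (b : A) *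
        ι (MonoidAlgebra.single h⁻¹ 1)) * ι (MonoidAlgebra.single g⁻¹ 1)
    have h₁ : MonoidAlgebra.single (g * h) (1 : k) =
        MonoidAlgebra.single g 1 * MonoidAlgebra.single h 1 := by
      simp [MonoidAlgebra.single_mul_single]
    have h₂ : MonoidAlgebra.single (g * h)⁻¹ (1 : k) =
        MonoidAlgebra.single h⁻¹ 1 * MonoidAlgebra.single g⁻¹ 1 := by
      simp [MonoidAlgebra.single_mul_single]
    rw [h₁, h₂, map_mul, map_mul]
    simp only [mul_assoc]

theorem coe_coinvConj (hπ : ∀ x, π (ι x) = x) (g : G) (b : rightCoinvariants π) :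
    (coinvConj hπ g b : A) =
      ι (MonoidAlgebra.single g 1) * b * ι (MonoidAlgebra.single g⁻¹ 1) := rfl

/-- The left adjoint action of `K` on the coinvariants. -/
def coinvAct (hπ : ∀ x, π (ι x) = x) :
    MonoidAlgebra k G →ₐ[k] Module.End k (rightCoinvariants π) :=
  MonoidAlgebra.lift k _ G (coinvConj hπ)

theorem coinvAct_single (hπ : ∀ x, π (ι x) = x) (g : G) (c : k) :
    coinvAct hπ (MonoidAlgebra.single g c) = c • coinvConj hπ g := by
  simp [coinvAct]

theorem coinvAct_one (hπ : ∀ x, π (ι x) = x) (h : MonoidAlgebra k G) :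
    coinvAct hπ h 1 = counit (R := k) h • (1 : rightCoinvariants π) := by
  induction h using MonoidAlgebra.induction_linear with
  | zero => simp
  | add x y hx hy => simp only [map_add, LinearMap.add_apply, hx, hy, add_smul]
  | single g c =>
    have : coinvConj hπ g 1 = 1 := Subtype.ext <| by
      rw [coe_coinvConj, OneMemClass.coe_one, mul_one, ← map_mul, single_mul_single_inv, map_one]
    simp [coinvAct_single, this]

theorem coinvAct_mul (hπ : ∀ x, π (ι x) = x) (h : MonoidAlgebra k G)
    (b c : rightCoinvariants π) : coinvAct hπ h (b * c) =
      LinearMap.mul' k _ (TensorProduct.map ((coinvAct hπ).toLinearMap.flip b)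
        ((coinvAct hπ).toLinearMap.flip c) (comul (R := k) h)) := by
  induction h using MonoidAlgebra.induction_linear with
  | zero => simp
  | add x y hx hy => simp only [map_add, LinearMap.add_apply, hx, hy]
  | single g r =>
    have : coinvConj hπ g (b * c) = coinvConj hπ g b * coinvConj hπ g c := Subtype.ext <| by
      rw [MulMemClass.coe_mul, coe_coinvConj, coe_coinvConj, coe_coinvConj, MulMemClass.coe_mul]
      simp only [mul_assoc]
      rw [← mul_assoc (ι (MonoidAlgebra.single g⁻¹ 1)) (ι (MonoidAlgebra.single g 1)), ← map_mul,
        single_inv_mul_single, map_one, one_mul]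
    simp [coinvAct_single, this]

theorem coinvCoact_coassoc (hπ : ∀ x, π (ι x) = x) (b : rightCoinvariants π) :
    TensorProduct.assoc k _ _ _ (comul.rTensor _ (coinvCoact hπ b)) =
      (coinvCoact hπ).lTensor _ (coinvCoact hπ b) := by
  have h₁ : ∀ y : A ⊗[k] A, TensorProduct.assoc k _ _ _ (comul.rTensor _
      (TensorProduct.map (π : A →ₗ[k] MonoidAlgebra k G) (coinvProj hπ) y)) =
      TensorProduct.map (π : A →ₗ[k] MonoidAlgebra k G)
        (TensorProduct.map (π : A →ₗ[k] MonoidAlgebra k G) (coinvProj hπ))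
        (TensorProduct.assoc k A A A (comul.rTensor A y)) := by
    intro y
    induction y using tensor_add_induction with
    | add y z hy hz => simp only [map_add, hy, hz]
    | tmul a b =>
      have : comul (R := k) ((π : A →ₗ[k] MonoidAlgebra k G) a) =
        pushforward π (comul (R := k) a) := (pushforward_comul π a).symm
      simp only [TensorProduct.map_tmul, LinearMap.rTensor_tmul, this]
      induction comul (R := k) a using tensor_add_induction with
      | add y z hy hz => simp only [map_add, TensorProduct.add_tmul, hy, hz]
      | tmul c d => simp
  have h₂ : ∀ y : A ⊗[k] A, TensorProduct.map (π : A →ₗ[k] MonoidAlgebra k G)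
      (TensorProduct.map (π : A →ₗ[k] MonoidAlgebra k G) (coinvProj hπ) ∘ₗ comul) y =
      TensorProduct.map (π : A →ₗ[k] MonoidAlgebra k G)
        (TensorProduct.map (π : A →ₗ[k] MonoidAlgebra k G) (coinvProj hπ)) (comul.lTensor A y) := by
    intro y
    rw [LinearMap.lTensor, TensorProduct.map_map, LinearMap.comp_id]
  -- The last rewrite inserts the projection between the two coactions, as the iterated coaction
  -- requires.
  conv_lhs => rw [coinvCoact_apply, h₁, coassoc_apply, ← h₂, ← map_coinvProj_comul hπ]
  rw [coinvCoact_apply, LinearMap.lTensor, TensorProduct.map_map,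
    LinearMap.id_comp]
  rfl

theorem coinvCoact_counit (hπ : ∀ x, π (ι x) = x) (b : rightCoinvariants π) :
    TensorProduct.lid k _ ((counit (R := k)).rTensor _ (coinvCoact hπ b)) = b := by
  have h : ∀ y : A ⊗[k] A, (counit (R := k)).rTensor _
      (TensorProduct.map (π : A →ₗ[k] MonoidAlgebra k G) (coinvProj hπ) y) =
      (coinvProj hπ).lTensor k ((counit (R := k)).rTensor A y) := by
    intro y
    induction y using tensor_add_induction with
    | add y z hy hz => simp only [map_add, hy, hz]
    | tmul a b =>
      rw [TensorProduct.map_tmul, LinearMap.rTensor_tmul, LinearMap.rTensor_tmul,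
        LinearMap.lTensor_tmul]
      congr 1
      exact CoalgHomClass.counit_comp_apply π a
  rw [coinvCoact_apply, h, rTensor_counit_comul]
  simp

theorem coinvCounit_coact (hπ : ∀ x, π (ι x) = x) (b : rightCoinvariants π) :
    TensorProduct.rid k _ ((coinvCounit π).lTensor _ (coinvCoact hπ b)) =
      coinvCounit π b • (1 : MonoidAlgebra k G) := by
  have h : ∀ y : A ⊗[k] A, (coinvCounit π).lTensor _
      (TensorProduct.map (π : A →ₗ[k] MonoidAlgebra k G) (coinvProj hπ) y) =
      (π : A →ₗ[k] MonoidAlgebra k G).rTensor k ((counit (R := k)).lTensor A y) := by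
    intro y
    induction y using tensor_add_induction with
    | add y z hy hz => simp only [map_add, hy, hz]
    | tmul a b => simp [coinvCounit_coinvProj]
  rw [coinvCoact_apply, h, lTensor_counit_comul, coinvCounit_apply,
    ← proj_of_mem_rightCoinvariants π b.2]
  simp

/-- The compatibility `∑ (Π v₁)⁽¹⁾ π(v₂) ⊗ (Π v₁)⁽²⁾ = ∑ π(v₁) ⊗ Π(v₂)` of the coaction with the
projection `Π` onto the coinvariants. -/
theorem coinvCoact_coinvProj_mul (hπ : ∀ x, π (ι x) = x) (v : A) :
    (LinearMap.mul' k (MonoidAlgebra k G)).rTensor (rightCoinvariants π)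
      (TensorProduct.rightComm k _ _ _ ((coinvCoact hπ ∘ₗ coinvProj hπ).rTensor _
        (rightCoaction π v))) =
      TensorProduct.map (π : A →ₗ[k] MonoidAlgebra k G) (coinvProj hπ) (comul (R := k) v) := by
  induction v using coinvariants_induction hπ with
  | add x y hx hy => simp only [map_add, hx, hy]
  | mul b g =>
    rw [rightCoaction_mul_single hπ b.2, LinearMap.rTensor_tmul, LinearMap.comp_apply,
      coinvProj_coe_mul_single, Bialgebra.comul_mul, comul_incl_single, coinvCoact_apply]
    induction comul (R := k) (b : A) using tensor_add_induction with
    | add y z hy hz => simp only [map_add, TensorProduct.add_tmul, add_mul, hy, hz]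
    | tmul c d => simp [coinvProj_mul_single, hπ]

/-- Both sides equal `π(b₁) ⊗ Π(b₂) ⊗ Π(b₃)`. On the right the coaction of the second factor is
`π(b₂) ⊗ Π(b₃)`, and the remaining product `(Π b₁)⁽¹⁾ π(b₂)` is handled by the compatibility of
coaction and projection. -/
theorem coinvComul_coact (hπ : ∀ x, π (ι x) = x) (b : rightCoinvariants π) :
    (coinvComul hπ).lTensor _ (coinvCoact hπ b) =
      (LinearMap.mul' k (MonoidAlgebra k G)).rTensor _
        (TensorProduct.tensorTensorTensorComm k _ _ _ _
          (TensorProduct.map (coinvCoact hπ) (coinvCoact hπ) (coinvComul hπ b))) := by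
  have h₁ : ∀ y : A ⊗[k] A, (coinvComul hπ).lTensor _
      (TensorProduct.map (π : A →ₗ[k] MonoidAlgebra k G) (coinvProj hπ) y) =
      TensorProduct.map (π : A →ₗ[k] MonoidAlgebra k G)
        (TensorProduct.map (coinvProj hπ) (coinvProj hπ)) (comul.lTensor A y) := by
    intro y
    induction y using tensor_add_induction with
    | add y z hy hz => simp only [map_add, hy, hz]
    | tmul a b => simp [coinvComul_coinvProj]
  have h₂ : ∀ y : A ⊗[k] A, TensorProduct.map (π : A →ₗ[k] MonoidAlgebra k G)
      (TensorProduct.map (coinvProj hπ) (coinvProj hπ))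
        (TensorProduct.assoc k A A A (comul.rTensor A y)) =
      TensorProduct.assoc k _ _ _ (TensorProduct.map (TensorProduct.map
        (π : A →ₗ[k] MonoidAlgebra k G) (coinvProj hπ) ∘ₗ comul) (coinvProj hπ) y) := by
    intro y
    induction y using tensor_add_induction with
    | add y z hy hz => simp only [map_add, hy, hz]
    | tmul a b =>
      simp only [TensorProduct.map_tmul, LinearMap.rTensor_tmul, LinearMap.comp_apply]
      induction comul (R := k) a using tensor_add_induction with
      | add y z hy hz => simp only [map_add, TensorProduct.add_tmul, hy, hz]
      | tmul c d => simp
  have h₃ : ∀ y : A ⊗[k] A, (LinearMap.mul' k (MonoidAlgebra k G)).rTensor _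
      (TensorProduct.tensorTensorTensorComm k _ _ _ _ (TensorProduct.map
        (coinvCoact hπ ∘ₗ coinvProj hπ)
        (TensorProduct.map (π : A →ₗ[k] MonoidAlgebra k G) (coinvProj hπ))
        (TensorProduct.assoc k A A A (comul.rTensor A y)))) =
      TensorProduct.assoc k _ _ _ (TensorProduct.map (TensorProduct.map
        (π : A →ₗ[k] MonoidAlgebra k G) (coinvProj hπ) ∘ₗ comul) (coinvProj hπ) y) := by
    intro y
    induction y using tensor_add_induction with
    | add y z hy hz => simp only [map_add, hy, hz]
    | tmul a b =>
      rw [TensorProduct.map_tmul, LinearMap.comp_apply, ← coinvCoact_coinvProj_mul,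
        rightCoaction_eq, LinearMap.rTensor_tmul]
      induction comul (R := k) a using tensor_add_induction with
      | add y z hy hz => simp only [map_add, TensorProduct.add_tmul, hy, hz]
      | tmul c d =>
        simp only [TensorProduct.assoc_tmul, TensorProduct.map_tmul, LinearMap.lTensor_tmul,
          LinearMap.rTensor_tmul]
        induction (coinvCoact hπ ∘ₗ coinvProj hπ) c using tensor_add_induction with
        | add y z hy hz => simp only [map_add, TensorProduct.add_tmul, hy, hz]
        | tmul h x => simp
  have h₄ : ∀ y : A ⊗[k] A, TensorProduct.map (coinvCoact hπ ∘ₗ coinvProj hπ)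
      (TensorProduct.map (π : A →ₗ[k] MonoidAlgebra k G) (coinvProj hπ) ∘ₗ comul) y =
      TensorProduct.map (coinvCoact hπ ∘ₗ coinvProj hπ)
        (TensorProduct.map (π : A →ₗ[k] MonoidAlgebra k G) (coinvProj hπ))
          (comul.lTensor A y) := by
    intro y
    rw [LinearMap.lTensor, TensorProduct.map_map, LinearMap.comp_id]
  have h₅ : TensorProduct.map (coinvCoact hπ) (coinvCoact hπ) (coinvComul hπ b) =
      TensorProduct.map (coinvCoact hπ ∘ₗ coinvProj hπ)
        (TensorProduct.map (π : A →ₗ[k] MonoidAlgebra k G) (coinvProj hπ))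
          (TensorProduct.assoc k A A A (comul.rTensor A (comul (b : A)))) := by
    rw [coassoc_apply, ← h₄, ← map_coinvProj_comul hπ, coinvComul_apply,
      TensorProduct.map_map]
    rfl
  rw [h₅, h₃, ← h₂, coassoc_apply, ← h₁, coinvCoact_apply]

/-- The biproduct structure on the coinvariants of a split Hopf algebra projection onto a group
algebra. -/
def coinvDatum (hπ : ∀ x, π (ι x) = x) :
    BiproductDatum k (MonoidAlgebra k G) (rightCoinvariants π) where
  toCoalgebra := coinvCoalgebra hπ
  act := coinvAct hπ
  coact := coinvCoact hπ
  act_one := coinvAct_one hπ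
  act_mul := coinvAct_mul hπ
  coact_coassoc := coinvCoact_coassoc hπ
  coact_counit := coinvCoact_counit hπ
  counit_coact := coinvCounit_coact hπ
  comul_coact := coinvComul_coact hπ

/-- On group elements this is `b g c l = b (g c g⁻¹) g l`. -/
theorem biproductEquiv_smashMul (hπ : ∀ x, π (ι x) = x)
    (x y : rightCoinvariants π ⊗[k] MonoidAlgebra k G) :
    biproductEquiv hπ ((coinvDatum hπ).smashMul (x ⊗ₜ[k] y)) =
      biproductEquiv hπ x * biproductEquiv hπ y := by
  induction x using tensor_single_induction with
  | add x x' hx hx' => simp only [TensorProduct.add_tmul, map_add, hx, hx', add_mul]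
  | tmul b g =>
    induction y using tensor_single_induction with
    | add y y' hy hy' => simp only [TensorProduct.tmul_add, map_add, hy, hy', mul_add]
    | tmul c l =>
      have h : (coinvDatum hπ).smashMul ((b ⊗ₜ[k] MonoidAlgebra.single g 1) ⊗ₜ[k]
          (c ⊗ₜ[k] MonoidAlgebra.single l 1)) =
          (b * coinvConj hπ g c) ⊗ₜ[k]
            (MonoidAlgebra.single g 1 * MonoidAlgebra.single l 1) := by
        have : (coinvDatum hπ).act = coinvAct hπ := rfl
        simp only [BiproductDatum.smashMul, LinearMap.comp_apply, LinearMap.rTensor_tmul,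
          LinearMap.lTensor_tmul, comul_single_one, LinearEquiv.coe_coe,
          TensorProduct.assoc_symm_tmul, TensorProduct.tensorTensorTensorComm_tmul,
          TensorProduct.map_tmul, TensorProduct.assoc_tmul, TensorProduct.lift.tmul,
          LinearMap.mul'_apply, this, AlgHom.toLinearMap_apply, coinvAct_single, one_smul]
      rw [h, biproductEquiv_apply, biproductEquiv_apply, biproductEquiv_apply, biproductMul_tmul,
        biproductMul_tmul, biproductMul_tmul, MulMemClass.coe_mul, coe_coinvConj, map_mul]
      simp only [mul_assoc]
      rw [← mul_assoc (ι (MonoidAlgebra.single g⁻¹ 1)) (ι (MonoidAlgebra.single g 1)), ← map_mul,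
        single_inv_mul_single, map_one, one_mul]

theorem counit_biproductEquiv (hπ : ∀ x, π (ι x) = x)
    (x : rightCoinvariants π ⊗[k] MonoidAlgebra k G) :
    counit (R := k) (biproductEquiv hπ x) = (coinvDatum hπ).smashCounit x := by
  induction x using tensor_single_induction with
  | add x x' hx hx' => simp only [map_add, hx, hx']
  | tmul b g =>
    have : (coinvDatum hπ).counit = coinvCounit π := rfl
    rw [biproductEquiv_apply, biproductMul_tmul, Bialgebra.counit_mul, counit_incl_single]
    simp [BiproductDatum.smashCounit, this, coinvCounit_apply]

variable (π) in
/-- The map `b ⊗ (h ⊗ c) ↦ (b ⊗ h g) ⊗ (c ⊗ g)`, which sends `b₁ ⊗ (b₂⁽¹⁾ ⊗ b₂⁽²⁾)` to the smash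
coproduct of `b ⊗ g`. -/
def smashComulSingle (g : G) :
    rightCoinvariants π ⊗[k] (MonoidAlgebra k G ⊗[k] rightCoinvariants π) →ₗ[k]
      (rightCoinvariants π ⊗[k] MonoidAlgebra k G) ⊗[k]
        (rightCoinvariants π ⊗[k] MonoidAlgebra k G) :=
  ((LinearMap.mul' k (MonoidAlgebra k G)).lTensor _ ∘ₗ
    (TensorProduct.assoc k _ _ _).toLinearMap).rTensor _ ∘ₗ
  (TensorProduct.tensorTensorTensorComm k _ _ _ _).toLinearMap ∘ₗ
  (TensorProduct.mk k _ _).flip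
    (MonoidAlgebra.single g (1 : k) ⊗ₜ[k] MonoidAlgebra.single g (1 : k)) ∘ₗ
  (TensorProduct.assoc k _ _ _).symm.toLinearMap

theorem smashComulSingle_tmul (g : G) (b c : rightCoinvariants π) (h : MonoidAlgebra k G) :
    smashComulSingle π g (b ⊗ₜ[k] (h ⊗ₜ[k] c)) =
      (b ⊗ₜ[k] (h * MonoidAlgebra.single g 1)) ⊗ₜ[k] (c ⊗ₜ[k] MonoidAlgebra.single g 1) := rfl

theorem smashComul_tmul_single (hπ : ∀ x, π (ι x) = x) (b : rightCoinvariants π) (g : G) :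
    (coinvDatum hπ).smashComul (b ⊗ₜ[k] MonoidAlgebra.single g 1) =
      smashComulSingle π g ((coinvCoact hπ).lTensor _ (coinvComul hπ b)) := by
  unfold BiproductDatum.smashComul
  rw [LinearMap.comp_apply, LinearMap.comp_apply, TensorProduct.map_tmul, comul_single_one]
  rfl

theorem lTensor_coinvCoact_coinvComul (hπ : ∀ x, π (ι x) = x) (b : rightCoinvariants π) :
    (coinvCoact hπ).lTensor _ (coinvComul hπ b) = TensorProduct.map (coinvProj hπ)
      (TensorProduct.map (π : A →ₗ[k] MonoidAlgebra k G) (coinvProj hπ))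
      (TensorProduct.assoc k A A A (comul.rTensor A (comul (b : A)))) := by
  have h : ∀ y : A ⊗[k] A, TensorProduct.map (coinvProj hπ)
      (TensorProduct.map (π : A →ₗ[k] MonoidAlgebra k G) (coinvProj hπ) ∘ₗ comul) y =
      TensorProduct.map (coinvProj hπ)
        (TensorProduct.map (π : A →ₗ[k] MonoidAlgebra k G) (coinvProj hπ))
        (comul.lTensor A y) := by
    intro y
    rw [LinearMap.lTensor, TensorProduct.map_map, LinearMap.comp_id]
  rw [coassoc_apply, ← h, ← map_coinvProj_comul hπ, coinvComul_apply, LinearMap.lTensor,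
    TensorProduct.map_map]
  rfl

/-- The first factor becomes `Π(a₁) ι(π(a₂)) ι(g)`, and `Π(a₁) ι(π(a₂)) = a`. A general tensor `y`
is allowed so that linearity can be used; later it is `Δ(b)`. -/
theorem map_biproductEquiv_smashComulSingle (hπ : ∀ x, π (ι x) = x) (g : G) (y : A ⊗[k] A) :
    TensorProduct.map (biproductEquiv hπ).toLinearMap (biproductEquiv hπ).toLinearMap
      (smashComulSingle π g (TensorProduct.map (coinvProj hπ)
        (TensorProduct.map (π : A →ₗ[k] MonoidAlgebra k G) (coinvProj hπ))
        (TensorProduct.assoc k A A A (comul.rTensor A y)))) =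
    ((rightCoinvariants π).val.toLinearMap ∘ₗ coinvProj hπ).lTensor A y *
      ι (MonoidAlgebra.single g 1) ⊗ₜ[k] ι (MonoidAlgebra.single g 1) := by
  induction y using tensor_add_induction with
  | add y z hy hz => simp only [map_add, hy, hz, add_mul]
  | tmul a b =>
    have h₃ := biproductMul_coinvProj_rightCoaction hπ a
    rw [rightCoaction_eq] at h₃
    rw [LinearMap.lTensor_tmul, LinearMap.rTensor_tmul, Algebra.TensorProduct.tmul_mul_tmul]
    conv_rhs => rw [← h₃]
    induction comul (R := k) a using tensor_add_induction with
    | add y z hy hz => simp only [map_add, TensorProduct.add_tmul, add_mul, hy, hz]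
    | tmul c d =>
      rw [TensorProduct.assoc_tmul, TensorProduct.map_tmul, TensorProduct.map_tmul,
        smashComulSingle_tmul, TensorProduct.map_tmul, LinearMap.lTensor_tmul,
        LinearMap.rTensor_tmul, LinearEquiv.coe_coe, biproductEquiv_apply, biproductEquiv_apply,
        biproductMul_tmul, biproductMul_tmul, biproductMul_tmul, map_mul, mul_assoc]
      rfl

theorem comul_biproductEquiv (hπ : ∀ x, π (ι x) = x)
    (x : rightCoinvariants π ⊗[k] MonoidAlgebra k G) :
    comul (R := k) (biproductEquiv hπ x) =
      TensorProduct.map (biproductEquiv hπ).toLinearMap (biproductEquiv hπ).toLinearMap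
        ((coinvDatum hπ).smashComul x) := by
  induction x using tensor_single_induction with
  | add x x' hx hx' => simp only [map_add, hx, hx']
  | tmul b g =>
    rw [smashComul_tmul_single, lTensor_coinvCoact_coinvComul, map_biproductEquiv_smashComulSingle,
      lTensor_coinvProj_comul, biproductEquiv_apply, biproductMul_tmul, Bialgebra.comul_mul,
      comul_incl_single]

/-- **Radford's theorem**: a Hopf algebra with a split projection onto a group algebra is the
biproduct of its coinvariants and the group algebra. -/
theorem isBiproductIso_biproductEquiv (hπ : ∀ x, π (ι x) = x) :
    (coinvDatum hπ).IsBiproductIso (biproductEquiv hπ) where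
  map_one := by simp [biproductEquiv_apply]
  map_mul := biproductEquiv_smashMul hπ
  map_counit := counit_biproductEquiv hπ
  map_comul := comul_biproductEquiv hπ

end Biproduct
end TriHopf
end

/-! ### Assembly of the two claims. -/

theorem theorem3p1 {k A : Type*} [Field k] [IsAlgClosed k] [CharZero k]
    [Ring A] [HopfAlgebra k A] (hA : TriHopf.IsPointed k A)
    (R : A ⊗[k] A) (hR : TriHopf.IsMinimalTriangular R) :
    (∃ π : A →ₐc[k] TriHopf.GroupLikeAlgebra k A,
      (∀ x : TriHopf.GroupLikeAlgebra k A, π (TriHopf.groupLikeIncl k A x) = x) ∧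
      ∃ (D : TriHopf.BiproductDatum k (TriHopf.GroupLikeAlgebra k A)
            (TriHopf.rightCoinvariants π))
        (e : TriHopf.rightCoinvariants π ⊗[k] TriHopf.GroupLikeAlgebra k A ≃ₗ[k] A),
        (∀ (b : TriHopf.rightCoinvariants π) (h : TriHopf.GroupLikeAlgebra k A),
          e (b ⊗ₜ[k] h) = (b : A) * TriHopf.groupLikeIncl k A h) ∧
        D.IsBiproductIso e) ∧
    (∃ RK : TriHopf.GroupLikeAlgebra k A ⊗[k] TriHopf.GroupLikeAlgebra k A,
      TriHopf.IsMinimalTriangular RK ∧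
      TriHopf.groupLikeIncl k A (TriHopf.drinfeldElement RK) = TriHopf.drinfeldElement R) :=
  have hπ := hR.proj_groupLikeIncl hA
  ⟨⟨hR.proj hA, hπ, TriHopf.coinvDatum hπ, TriHopf.biproductEquiv hπ,
    TriHopf.biproductMul_tmul, TriHopf.isBiproductIso_biproductEquiv hπ⟩,
    _, hR.pushforward_proj hA, hR.groupLikeIncl_drinfeldElement_pushforward hA⟩
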